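/- Let $M$ be a connected (smooth, Hausdorff) $7$-manifold with a $\mathrm{G}_2$-structure, that is, a smooth $3$-form $\varphi$ on $M$ such that at each point $p$ there is a basis of $T_pM$, with dual basis $e^1,\dots,e^7$, for which $$\varphi_p = e^{123}-e^1\wedge(e^{45}+e^{67})-e^2\wedge(e^{46}+e^{75})-e^3\wedge(e^{47}+e^{56}),$$ where $e^{ij}=e^i\wedge e^j$ and $e^{ijk}=e^i\wedge e^j\wedge e^k$. Suppose that the torus $T^3=(S^1)^3$ acts smoothly and effectively on $M$, preserving $\varphi$, so that the orbits are isotropic for $\varphi$: for all $p\in M$ and all $u,v,w$ in the Lie algebra $\mathfrak t^3\cong\mathbb{R}^3$ of $T^3$, $$\varphi_p(\xi(u)_p,\xi(v)_p,\xi(w)_p)=0,\qquad\text{where } \xi(v)_p=\left.\tfrac{d}{dt}\right|_{t=0}\exp(tv)\cdot p .$$ Then for each $p\in M$ the isotropy group $H_p=\{g\in T^3 : g\cdot p=p\}$ is connected and of dimension at most $2$. Hence each $H_p$ is trivial or isomorphic, as a Lie group, to the circle $S^1$ or to the two-torus $T^2=S^1\times S^1$. -/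

import Mathlib

open scoped Manifold ContDiff

noncomputable section

namespace ToricG2

/-- The three-dimensional torus as a Lie group. -/
abbrev T3 : Type := Circle × Circle × Circle

/-- The model with corners (no boundary) of the torus. -/
abbrev modelT3 := (𝓡 1).prod ((𝓡 1).prod (𝓡 1))

/-- The exponential map of the torus, its Lie algebra being identified with `ℝ³`. -/
def expT3 (v : Fin 3 → ℝ) : T3 := (Circle.exp (v 0), Circle.exp (v 1), Circle.exp (v 2))

theorem expT3_zero : expT3 0 = 1 := by
  simp [expT3]

theorem expT3_add (v w : Fin 3 → ℝ) : expT3 (v + w) = expT3 v * expT3 w := by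
  simp [expT3, Circle.exp_add]

/-- The Lie algebra of a subgroup `H` of the torus: all `v` whose one-parameter group
`t ↦ exp (t v)` stays in `H`. -/
def lieAlgebraOf (H : Subgroup T3) : Submodule ℝ (Fin 3 → ℝ) where
  carrier := {v | ∀ t : ℝ, expT3 (t • v) ∈ H}
  zero_mem' := fun t => by
    rw [smul_zero, expT3_zero]
    exact H.one_mem
  add_mem' := fun {v w} hv hw t => by
    rw [smul_add, expT3_add]
    exact H.mul_mem (hv t) (hw t)
  smul_mem' := fun c v hv t => by
    rw [smul_smul]
    exact hv (t * c)

/-- The dimension of a (closed) subgroup of the torus, as a Lie group. -/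
def lieDim (H : Subgroup T3) : ℕ := Module.finrank ℝ (lieAlgebraOf H)

/-- The 3-form `eⁱ ∧ eʲ ∧ eᵏ` on `ℝ⁷` (indices start at `0`):
`(u₀, u₁, u₂) ↦ det (u_a)_b` with `b` ranging over the coordinates `i, j, k`. -/
def coordForm (i j k : Fin 7) : (Fin 7 → ℝ) [⋀^Fin 3]→ₗ[ℝ] ℝ :=
  Matrix.detRowAlternating.compLinearMap (LinearMap.funLeft ℝ ℝ ![i, j, k])

/-- The model form
`φ₀ = e¹²³ - e¹(e⁴⁵ + e⁶⁷) - e²(e⁴⁶ + e⁷⁵) - e³(e⁴⁷ + e⁵⁶)` on `ℝ⁷`. -/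
def phi0 : (Fin 7 → ℝ) [⋀^Fin 3]→ₗ[ℝ] ℝ :=
  coordForm 0 1 2 - (coordForm 0 3 4 + coordForm 0 5 6)
    - (coordForm 1 3 5 + coordForm 1 6 4) - (coordForm 2 3 6 + coordForm 2 4 5)

section Manifold

variable {M : Type*} [TopologicalSpace M] [ChartedSpace (EuclideanSpace ℝ (Fin 7)) M]

/-- A field of alternating 3-forms on the tangent spaces of a 7-manifold
(smoothness is imposed separately). -/
abbrev ThreeForm (M : Type*) [TopologicalSpace M]
    [ChartedSpace (EuclideanSpace ℝ (Fin 7)) M] : Type _ :=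
  (p : M) → TangentSpace (𝓡 7) p [⋀^Fin 3]→L[ℝ] ℝ

/-- A 3-form is smooth if its pullback under the inverse of each chart is a smooth map from
the target of the chart to the alternating 3-forms on `ℝ⁷`. -/
def ThreeForm.Smooth (φ : ThreeForm M) : Prop :=
  ∀ e ∈ atlas (EuclideanSpace ℝ (Fin 7)) M,
    ContDiffOn ℝ ∞
      (fun y : EuclideanSpace ℝ (Fin 7) =>
        ((φ (e.symm y)).compContinuousLinearMap (mfderiv (𝓡 7) (𝓡 7) e.symm y) :
          EuclideanSpace ℝ (Fin 7) [⋀^Fin 3]→L[ℝ] ℝ))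
      e.target

/-- A `G₂`-structure: a smooth 3-form that is pointwise linearly equivalent to `φ₀`. -/
structure IsG2Structure (φ : ThreeForm M) : Prop where
  smooth : φ.Smooth
  pointwise : ∀ p : M, ∃ L : (Fin 7 → ℝ) ≃ₗ[ℝ] TangentSpace (𝓡 7) p,
    (φ p).toAlternatingMap.compLinearMap L.toLinearMap = phi0

/-- The action preserves `φ`: every `g` satisfies `g^* φ = φ`. -/
def Preserves [MulAction T3 M] (φ : ThreeForm M) : Prop :=
  ∀ (g : T3) (p : M),
    (φ (g • p)).compContinuousLinearMap (mfderiv (𝓡 7) (𝓡 7) (fun x : M => g • x) p) = φ p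

/-- The value at `p` of the fundamental vector field of `v`:
the velocity at `t = 0` of the curve `t ↦ exp (t v) • p`. -/
def fundamental [MulAction T3 M] (v : Fin 3 → ℝ) (p : M) : TangentSpace (𝓡 7) p :=
  (mfderiv 𝓘(ℝ, ℝ) (𝓡 7) (fun t : ℝ => expT3 (t • v) • p) 0 (1 : ℝ) :
    EuclideanSpace ℝ (Fin 7))

/-- The orbits are isotropic for `φ`: at each point, `φ` vanishes on triples of values of
fundamental vector fields. -/
def IsotropicOrbits [MulAction T3 M] (φ : ThreeForm M) : Prop :=
  ∀ (p : M) (v : Fin 3 → Fin 3 → ℝ), φ p (fun i => fundamental (v i) p) = 0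

end Manifold

end ToricG2

end

/-! Let `H` be the stabilizer of `p`. It acts on the tangent space at `p` preserving the model form,
hence by automorphisms of the cross product of ℝ⁷, which are isometries
(`PreservesCross.inner_map_map`). As the torus is abelian, `H` fixes every velocity of the orbit.
These velocities span a space of dimension `3 - lieDim H` on which the form vanishes. On a connected
manifold an effective compact action has faithful isotropy representations
(`eq_one_of_isotropyDeriv_eq_id`), so it is enough to find few characters that detect the identity.
The key is rigidity (`PreservesCross.eq_one_of_fixed`): an automorphism fixing nonzero, pairwise
orthogonal `a`, `b`, `c` with `c` orthogonal to `a × b` is the identity. A fixed unit vector `u`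
makes its orthogonal complement a complex space with structure `u × ·`, on which the commuting
operators have joint eigenvectors, and each eigenvector gives a character. Thus three fixed
velocities force `H` to be trivial, two embed it in a circle, and one embeds it in a two-torus. In
each case the number of characters equals `lieDim H`, so the embedding is onto
(`nonempty_continuousMulEquiv`). Connectedness is therefore a conclusion and is never assumed of
`H`. Dimension 3 would make `H` the whole torus, which still fixes a nonzero vector by divisibility
(`exists_fixed_of_square`) and so would embed in a two-torus, a contradiction. -/

open scoped RealInnerProductSpace

namespace ToricG2

/-! ### The cross product of `ℝ⁷` -/

/-- The Euclidean model space of the tangent spaces. -/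
abbrev E7 : Type := EuclideanSpace ℝ (Fin 7)

/-- The components of the cross product determined by `phi0` and the Euclidean metric. -/
def crossFun (u v : E7) : E7 :=
  !₂[(u 1 * v 2 - u 2 * v 1) - (u 3 * v 4 - u 4 * v 3) - (u 5 * v 6 - u 6 * v 5),
    (u 2 * v 0 - u 0 * v 2) - (u 3 * v 5 - u 5 * v 3) - (u 6 * v 4 - u 4 * v 6),
    (u 0 * v 1 - u 1 * v 0) - (u 3 * v 6 - u 6 * v 3) - (u 4 * v 5 - u 5 * v 4),
    -(u 4 * v 0 - u 0 * v 4) - (u 5 * v 1 - u 1 * v 5) - (u 6 * v 2 - u 2 * v 6),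
    -(u 0 * v 3 - u 3 * v 0) - (u 1 * v 6 - u 6 * v 1) - (u 5 * v 2 - u 2 * v 5),
    -(u 6 * v 0 - u 0 * v 6) - (u 1 * v 3 - u 3 * v 1) - (u 2 * v 4 - u 4 * v 2),
    -(u 0 * v 5 - u 5 * v 0) - (u 4 * v 1 - u 1 * v 4) - (u 2 * v 3 - u 3 * v 2)]

/-- The cross product of `ℝ⁷` determined by `phi0` and the Euclidean metric. -/
def cross : E7 →ₗ[ℝ] E7 →ₗ[ℝ] E7 :=
  LinearMap.mk₂ ℝ crossFun
    (fun u v w => by ext i; fin_cases i <;> simp [crossFun] <;> ring)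
    (fun c u v => by ext i; fin_cases i <;> simp [crossFun] <;> ring)
    (fun u v w => by ext i; fin_cases i <;> simp [crossFun] <;> ring)
    (fun c u v => by ext i; fin_cases i <;> simp [crossFun] <;> ring)

theorem cross_apply (u v : E7) : cross u v = crossFun u v := rfl

theorem inner_eq_sum_seven (x y : E7) :
    ⟪x, y⟫ = x 0 * y 0 + x 1 * y 1 + x 2 * y 2 + x 3 * y 3 + x 4 * y 4 + x 5 * y 5
      + x 6 * y 6 := by
  simp [PiLp.inner_apply, Fin.sum_univ_seven, mul_comm]

theorem coordForm_apply (i j k : Fin 7) (u v w : Fin 7 → ℝ) :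
    coordForm i j k ![u, v, w] = u i * v j * w k - u i * v k * w j - u j * v i * w k
      + u j * v k * w i + u k * v i * w j - u k * v j * w i := by
  have h : coordForm i j k ![u, v, w]
      = Matrix.det (Matrix.of fun a b => (![u, v, w] : Fin 3 → Fin 7 → ℝ) a (![i, j, k] b)) := rfl
  rw [h, Matrix.det_fin_three]
  simp

theorem phi0_eq_inner_cross (u v w : E7) :
    phi0 ![u.ofLp, v.ofLp, w.ofLp] = ⟪cross u v, w⟫ := by
  rw [inner_eq_sum_seven, cross_apply]
  simp only [phi0, AlternatingMap.sub_apply, AlternatingMap.add_apply, coordForm_apply]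
  simp [crossFun]
  ring

theorem cross_self (u : E7) : cross u u = 0 := by
  ext i
  fin_cases i <;> simp [cross_apply, crossFun] <;> ring

theorem cross_anticomm (u v : E7) : cross u v = -cross v u := by
  have h := cross_self (u + v)
  simp only [map_add, LinearMap.add_apply, cross_self, zero_add, add_zero] at h
  rw [eq_neg_iff_add_eq_zero, add_comm]
  exact h

theorem inner_cross_cyclic (u v w : E7) : ⟪cross u v, w⟫ = ⟪cross v w, u⟫ := by
  simp only [inner_eq_sum_seven, cross_apply]
  simp [crossFun]
  ring

theorem inner_cross_right (u v w : E7) : ⟪v, cross u w⟫ = -⟪cross u v, w⟫ := by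
  rw [real_inner_comm, cross_anticomm u v, inner_neg_left, neg_neg, inner_cross_cyclic,
    inner_cross_cyclic w v u, inner_cross_cyclic v u w, inner_cross_cyclic u w v]

/-- Octonionic identity behind everything below: for a unit vector `u`, the operator `u × ·` squares
to `-1` on the orthogonal complement of `u`. -/
theorem cross_cross_self (u v : E7) : cross u (cross u v) = ⟪u, v⟫ • u - ⟪u, u⟫ • v := by
  ext i
  simp only [inner_eq_sum_seven, cross_apply]
  fin_cases i <;> simp [crossFun] <;> ring

/-- Polarization of `cross_cross_self` in `u`. -/
theorem cross_cross_swap (u v w : E7) :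
    cross u (cross v w) + cross v (cross u w)
      = ⟪u, w⟫ • v + ⟪v, w⟫ • u - (2 * ⟪u, v⟫) • w := by
  ext i
  simp only [inner_eq_sum_seven, cross_apply]
  fin_cases i <;> simp [crossFun] <;> ring

/-! ### Maps preserving the model form are isometries -/

/-- `g` preserves the model form, expressed through the cross product. -/
def PreservesCross (g : E7 →ₗ[ℝ] E7) : Prop :=
  ∀ x y z, ⟪cross (g x) (g y), g z⟫ = ⟪cross x y, z⟫

theorem det_adjoint (f : E7 →ₗ[ℝ] E7) : LinearMap.det (LinearMap.adjoint f) = LinearMap.det f := by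
  let b := EuclideanSpace.basisFun (Fin 7) ℝ
  rw [← LinearMap.det_toMatrix b.toBasis, ← LinearMap.det_toMatrix b.toBasis,
    LinearMap.toMatrix_adjoint, Matrix.det_conjTranspose, star_trivial]

/-- The operator `x ↦ u × x + ⟪η, x⟫ u`. -/
noncomputable def crossAdd (u η : E7) : E7 →ₗ[ℝ] E7 := cross u + (innerₗ E7 η).smulRight u

theorem crossAdd_apply (u η x : E7) : crossAdd u η x = cross u x + ⟪η, x⟫ • u := rfl

theorem adjoint_crossAdd_self (u x : E7) :
    LinearMap.adjoint (crossAdd u u) x = ⟪u, x⟫ • u - cross u x := by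
  refine ext_inner_right ℝ fun y => ?_
  rw [LinearMap.adjoint_inner_left, crossAdd_apply, inner_add_right, inner_sub_left,
    inner_smul_left, inner_smul_right, inner_cross_right, real_inner_comm x u]
  simp
  ring

/-- The operator `u × ·` alone is singular, since it kills `u`; the rank-one term repairs this.
Composing with the adjoint for `η = u` leaves a multiple of a rank-one perturbation of the identity,
whose determinant is explicit. -/
theorem crossAdd_comp_adjoint {u : E7} (hu : u ≠ 0) (η : E7) :
    crossAdd u η ∘ₗ LinearMap.adjoint (crossAdd u u) = ⟪u, u⟫ • LinearMap.transvection
      (⟪u, u⟫⁻¹ • innerₗ E7 (-u + cross u η + ⟪u, η⟫ • u)) u := by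
  have h0 : ⟪u, u⟫ ≠ 0 := inner_self_ne_zero.mpr hu
  ext1 x
  simp only [LinearMap.comp_apply, LinearMap.smul_apply, LinearMap.transvection.apply,
    adjoint_crossAdd_self, crossAdd_apply, map_sub, map_smul, cross_self, cross_cross_self,
    innerₗ_apply_apply, inner_add_left, inner_neg_left,
    inner_smul_left, inner_cross_right, smul_add, smul_smul, smul_eq_mul, real_inner_comm η u]
  rw [← mul_assoc ⟪u, u⟫, mul_inv_cancel₀ h0]
  simp
  module

theorem det_crossAdd_sq {u : E7} (hu : u ≠ 0) (η : E7) :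
    LinearMap.det (crossAdd u η) ^ 2 = ⟪u, u⟫ ^ 6 * ⟪u, η⟫ ^ 2 := by
  have h0 : ⟪u, u⟫ ≠ 0 := inner_self_ne_zero.mpr hu
  have key : ∀ η, LinearMap.det (crossAdd u η) * LinearMap.det (crossAdd u u)
      = ⟪u, u⟫ ^ 7 * ⟪u, η⟫ := by
    intro η
    rw [← det_adjoint (crossAdd u u), ← LinearMap.det_comp, crossAdd_comp_adjoint hu,
      LinearMap.det_smul, LinearMap.transvection.det]
    have : ⟪cross u η, u⟫ = 0 := by rw [real_inner_comm, inner_cross_right, cross_self]; simp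
    simp [this]
    field_simp
    simp
  have h1 := key u
  have h2 := key η
  have h3 : (LinearMap.det (crossAdd u η) * LinearMap.det (crossAdd u u)) ^ 2
      = (⟪u, u⟫ ^ 7 * ⟪u, η⟫) ^ 2 := by rw [h2]
  rw [mul_pow, sq (LinearMap.det (crossAdd u u)), h1] at h3
  have h4 : ⟪u, u⟫ ^ 8 ≠ 0 := pow_ne_zero _ h0
  apply mul_right_cancel₀ h4
  linear_combination h3

/-- The form determines the metric up to the factor `|det g|`, through determinants of `crossAdd`:
`g` intertwines the bilinear forms of two such operators, and comparing squared determinants gives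
`(|d| n')⁴ = n⁴`, where `n` and `n'` are the squared norms of `u` and `g u`. -/
theorem PreservesCross.abs_det_mul {g : E7 ≃ₗ[ℝ] E7} (hg : PreservesCross g.toLinearMap) (u : E7) :
    |LinearMap.det g.toLinearMap| * ⟪g u, g u⟫ = ⟪u, u⟫ := by
  rcases eq_or_ne u 0 with rfl | hu
  · simp
  have hgu : g u ≠ 0 := by simpa using hu
  have h0 : 0 < ⟪u, u⟫ := real_inner_self_pos.mpr hu
  have h0' : 0 < ⟪g u, g u⟫ := real_inner_self_pos.mpr hgu
  set G := g.toLinearMap with hG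
  -- The inverse transpose of `g` turns pairing with `u` into pairing with `ξ` after `g`.
  set ξ : E7 := LinearMap.adjoint g.symm.toLinearMap u with hξ
  have hξg : ∀ x, ⟪ξ, g x⟫ = ⟪u, x⟫ := by
    intro x
    rw [hξ, LinearMap.adjoint_inner_left]
    simp
  have hconj : LinearMap.adjoint G ∘ₗ LinearMap.adjoint (crossAdd (g u) (-ξ)) ∘ₗ G
      = -crossAdd u (LinearMap.adjoint G (g u)) := by
    ext1 x
    refine ext_inner_right ℝ fun y => ?_
    simp only [LinearMap.comp_apply, LinearMap.adjoint_inner_left, LinearMap.neg_apply,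
      crossAdd_apply, inner_add_right, inner_neg_left, inner_add_left, inner_smul_left,
      inner_smul_right, inner_cross_right]
    have h1 := hg u x y
    have h2 := hξg y
    have h3 : G x = g x := rfl
    simp only [hG, LinearEquiv.coe_coe] at h1 ⊢
    rw [h1, h2, real_inner_comm (g u) (g x)]
    simp
    ring
  have hneg (f : E7 →ₗ[ℝ] E7) : LinearMap.det (-f) ^ 2 = LinearMap.det f ^ 2 := by
    rw [← neg_one_smul ℝ, LinearMap.det_smul, mul_pow, ← pow_mul, mul_comm _ 2, pow_mul]
    simp
  have hdet := congrArg (fun f => LinearMap.det f ^ 2) hconj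
  simp only [LinearMap.det_comp, det_adjoint, hneg, mul_pow, det_crossAdd_sq hu,
    det_crossAdd_sq hgu, LinearMap.adjoint_inner_right] at hdet
  have h1 : ⟪g u, -ξ⟫ = -⟪u, u⟫ := by rw [inner_neg_right, real_inner_comm, hξg]
  have h2 : ⟪G u, g u⟫ = ⟪g u, g u⟫ := rfl
  rw [h1, h2] at hdet
  generalize LinearMap.det G = d at hdet ⊢
  generalize ⟪g u, g u⟫ = n' at *
  generalize ⟪u, u⟫ = n at *
  have h3 : (|d| * n') ^ 4 = n ^ 4 := by
    have : (n' * n) ^ 2 ≠ 0 := by positivity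
    apply mul_left_cancel₀ this
    rw [mul_pow |d|, show |d| ^ 4 = d ^ 4 by rw [← abs_pow]; exact abs_of_nonneg (by positivity)]
    simp at hdet
    linear_combination hdet
  exact (pow_left_inj₀ (by positivity) h0.le (by norm_num)).mp h3

theorem PreservesCross.inner_map_map {g : E7 ≃ₗ[ℝ] E7} (hg : PreservesCross g.toLinearMap)
    (x y : E7) : ⟪g x, g y⟫ = ⟪x, y⟫ := by
  have hq := hg.abs_det_mul
  set d := LinearMap.det g.toLinearMap with hd
  have hpol : ∀ x y, |d| * ⟪g x, g y⟫ = ⟪x, y⟫ := by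
    intro x y
    have h1 := hq (x + y)
    have h2 := hq x
    have h3 := hq y
    simp only [map_add, inner_add_left, inner_add_right, real_inner_comm (g x) (g y),
      real_inner_comm x y] at h1
    linarith
  -- Taking determinants in dimension 7 gives `|d| ^ (7 + 2) = 1`, so `|d| = 1`.
  have hcomp : |d| • (LinearMap.adjoint g.toLinearMap ∘ₗ g.toLinearMap) = LinearMap.id := by
    ext1 x
    refine ext_inner_right ℝ fun y => ?_
    simp [inner_smul_left, LinearMap.adjoint_inner_left, hpol]
  have hdet := congrArg LinearMap.det hcomp
  rw [LinearMap.det_smul, LinearMap.det_comp, det_adjoint, ← hd, LinearMap.det_id,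
    finrank_euclideanSpace_fin, ← sq, ← sq_abs, ← pow_add] at hdet
  have h1 : |d| = 1 := (pow_eq_one_iff_of_nonneg (abs_nonneg d) (by norm_num)).mp hdet
  have := hpol x y
  rwa [h1, one_mul] at this

end ToricG2

/-! ### Joint eigenvectors of commuting families -/

/-- If every operator is scalar, any nonzero vector works. Otherwise an eigenspace of a non-scalar
member is proper, nonzero and stable under the whole family, so induction on the dimension applies;
the family may be infinite. -/
theorem Module.End.exists_joint_eigenvector {K : Type*} [Field K] [IsAlgClosed K] {ι : Type*}
    (n : ℕ) : ∀ {V : Type*} [AddCommGroup V] [Module K V] [FiniteDimensional K V] [Nontrivial V]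
      (T : ι → Module.End K V), (∀ i j, Commute (T i) (T j)) → Module.finrank K V = n →
      ∃ v : V, v ≠ 0 ∧ ∀ i, ∃ c : K, T i v = c • v := by
  induction n using Nat.strong_induction_on with
  | _ n ih =>
    intro V _ _ _ _ T hT hn
    by_cases hs : ∀ i, ∃ c : K, T i = c • 1
    · obtain ⟨v, hv⟩ := exists_ne (0 : V)
      refine ⟨v, hv, fun i => ?_⟩
      obtain ⟨c, hc⟩ := hs i
      exact ⟨c, by simp [hc]⟩
    · push Not at hs
      obtain ⟨i, hi⟩ := hs
      obtain ⟨μ, hμ⟩ := Module.End.exists_eigenvalue (T i)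
      set W := (T i).eigenspace μ with hW
      have hmaps : ∀ j, Set.MapsTo (T j) W W :=
        fun j => Module.End.mapsTo_genEigenspace_of_comm (hT i j) μ 1
      have hWtop : W < ⊤ := by
        refine lt_top_iff_ne_top.mpr fun h => hi μ ?_
        ext x
        have : x ∈ W := h ▸ Submodule.mem_top
        simpa using Module.End.mem_eigenspace_iff.mp this
      have : Nontrivial W := Submodule.nontrivial_iff_ne_bot.mpr hμ
      obtain ⟨v, hv, hvT⟩ := ih (Module.finrank K W) (hn ▸ Submodule.finrank_lt hWtop.ne)
        (fun j => (T j).restrict (hmaps j))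
        (fun j k => by ext x; exact congrArg (fun f => f (x : V)) (hT j k)) rfl
      refine ⟨v, by simpa using hv, fun j => ?_⟩
      obtain ⟨c, hc⟩ := hvT j
      exact ⟨c, congrArg Subtype.val hc⟩

theorem exists_joint_complex_eigenvector {V : Type*} [AddCommGroup V] [Module ℝ V]
    [FiniteDimensional ℝ V] [Nontrivial V] {ι : Type*} (J : Module.End ℝ V) (hJ : J * J = -1)
    (T : ι → Module.End ℝ V) (hT : ∀ i j, Commute (T i) (T j)) (hTJ : ∀ i, Commute (T i) J) :
    ∃ v : V, v ≠ 0 ∧ ∀ i, ∃ a b : ℝ, T i v = a • v + b • J v := by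
  let _ : Module ℂ V := Module.compHom V (Complex.liftAux J hJ).toRingHom
  have hsmul : ∀ (c : ℂ) (v : V), c • v = c.re • v + c.im • J v := by
    intro c v
    change (Complex.liftAux J hJ c) v = _
    simp [Complex.liftAux_apply, Algebra.algebraMap_eq_smul_one]
  have : IsScalarTower ℝ ℂ V := ⟨fun r c v => by simp [hsmul, smul_smul]⟩
  have : FiniteDimensional ℂ V := FiniteDimensional.right ℝ ℂ V
  let T' : ι → Module.End ℂ V := fun i =>
    { toFun := T i
      map_add' := map_add _
      map_smul' := fun c v => by
        have := congrArg (fun f => f v) (hTJ i)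
        simp only [Module.End.mul_apply] at this
        simp [hsmul, this] }
  obtain ⟨v, hv, h⟩ := Module.End.exists_joint_eigenvector _ T'
    (fun i j => by ext x; exact congrArg (fun f => f x) (hT i j)) rfl
  refine ⟨v, hv, fun i => ?_⟩
  obtain ⟨c, hc⟩ := h i
  exact ⟨c.re, c.im, by rw [← hsmul]; exact hc⟩

theorem Submodule.exists_joint_complex_eigenvector {V : Type*} [AddCommGroup V] [Module ℝ V]
    [FiniteDimensional ℝ V] {ι : Type*} {W : Submodule ℝ V} (hW : W ≠ ⊥) (J : V →ₗ[ℝ] V)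
    (hJW : ∀ x ∈ W, J x ∈ W) (hJ : ∀ x ∈ W, J (J x) = -x) (T : ι → V →ₗ[ℝ] V)
    (hTW : ∀ i, ∀ x ∈ W, T i x ∈ W) (hT : ∀ i j x, T i (T j x) = T j (T i x))
    (hTJ : ∀ i x, T i (J x) = J (T i x)) :
    ∃ v ∈ W, v ≠ 0 ∧ ∀ i, ∃ a b : ℝ, T i v = a • v + b • J v := by
  have : Nontrivial W := Submodule.nontrivial_iff_ne_bot.mpr hW
  obtain ⟨v, hv, h⟩ := _root_.exists_joint_complex_eigenvector (J.restrict hJW)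
    (by ext x; simpa using hJ x x.2) (fun i => (T i).restrict (hTW i))
    (fun i j => by ext x; exact hT i j x) (fun i => by ext x; exact hTJ i x)
  refine ⟨v, v.2, by simpa using hv, fun i => ?_⟩
  obtain ⟨a, b, hab⟩ := h i
  exact ⟨a, b, by simpa using congrArg Subtype.val hab⟩

namespace ToricG2

/-! ### Rigidity of cross product automorphisms -/

theorem PreservesCross.map_cross {g : E7 ≃ₗ[ℝ] E7} (hg : PreservesCross g.toLinearMap)
    (x y : E7) : g (cross x y) = cross (g x) (g y) := by
  refine ext_inner_right ℝ fun z => ?_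
  obtain ⟨z, rfl⟩ := g.surjective z
  rw [hg.inner_map_map]
  exact (hg x y z).symm

theorem inner_cross_self_left (u v : E7) : ⟪u, cross u v⟫ = 0 := by
  rw [inner_cross_right, cross_self, inner_zero_left, neg_zero]

theorem inner_cross_self_right (u v : E7) : ⟪v, cross u v⟫ = 0 := by
  rw [cross_anticomm, inner_neg_right, inner_cross_self_left, neg_zero]

theorem inner_cross_cross (u v w : E7) :
    ⟪cross u v, cross u w⟫ = ⟪u, u⟫ * ⟪v, w⟫ - ⟪u, v⟫ * ⟪u, w⟫ := by
  rw [inner_cross_right, cross_cross_self, inner_sub_left, inner_smul_left, inner_smul_left]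
  simp

/-- Octonion multiplication is anti-associative here: re-bracketing costs a sign. -/
theorem cross_assoc_of_orthogonal {p q y : E7} (hpq : ⟪p, q⟫ = 0) (hp : ⟪p, y⟫ = 0)
    (hq : ⟪q, y⟫ = 0) : cross (cross p q) y = -cross p (cross q y) := by
  have h := cross_cross_swap y p q
  rw [real_inner_comm, hq, hpq, real_inner_comm, hp] at h
  rw [cross_anticomm _ y, cross_anticomm q y, map_neg]
  simp only [zero_smul, mul_zero, add_zero, sub_zero] at h
  rw [eq_neg_of_add_eq_zero_left h]

theorem eq_zero_of_cross_eq_zero {a x : E7} (ha : a ≠ 0) (hax : ⟪a, x⟫ = 0)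
    (h : cross a x = 0) : x = 0 := by
  have h2 := cross_cross_self a x
  rw [h, hax, map_zero, zero_smul, zero_sub, zero_eq_neg, smul_eq_zero] at h2
  exact h2.resolve_left (inner_self_ne_zero.mpr ha)

theorem PreservesCross.eq_one_of_fixed {g : E7 ≃ₗ[ℝ] E7} (hg : PreservesCross g.toLinearMap)
    {a b c : E7} (ha : g a = a) (hb : g b = b) (hc : g c = c) (ha0 : a ≠ 0) (hb0 : b ≠ 0)
    (hc0 : c ≠ 0) (hab : ⟪a, b⟫ = 0) (hac : ⟪a, c⟫ = 0) (hbc : ⟪b, c⟫ = 0)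
    (habc : ⟪cross a b, c⟫ = 0) : g = 1 := by
  let F : Submodule ℝ E7 := LinearMap.eqLocus g.toLinearMap LinearMap.id
  have memF : ∀ x, x ∈ F ↔ g x = x := fun x => Iff.rfl
  have hF : ∀ x ∈ F, ∀ y ∈ F, cross x y ∈ F := by
    intro x hx y hy
    rw [memF] at *
    rw [hg.map_cross, hx, hy]
  have hFo : ∀ x ∈ F, ∀ y ∈ Fᗮ, cross x y ∈ Fᗮ := by
    intro x hx y hy z hz
    have := hy _ (hF x hx z hz)
    rw [inner_cross_right, this, neg_zero]
  suffices hbot : Fᗮ = ⊥ by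
    ext1 x
    have htop : F = ⊤ := (Submodule.orthogonal_eq_bot_iff).mp hbot
    exact (memF x).mp (htop ▸ Submodule.mem_top)
  rw [eq_bot_iff]
  intro y hy
  have hcy := hFo c hc y hy
  have hbcy := hFo b hb _ hcy
  have h1 := cross_assoc_of_orthogonal hab (hcy a ha) (hcy b hb)
  have h2 := cross_assoc_of_orthogonal habc (hy _ (hF a ha b hb)) (hy c hc)
  have h3 := cross_assoc_of_orthogonal hab hac hbc
  have habc' : ⟪a, cross b c⟫ = 0 := by rw [real_inner_comm, ← inner_cross_cyclic, habc]
  have h4 := cross_assoc_of_orthogonal habc' (hy a ha) (hy _ (hF b hb c hc))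
  have h5 := cross_assoc_of_orthogonal hbc (hy b hb) (hy c hc)
  -- The five re-bracketings go round the associativity pentagon of `a`, `b`, `c`, `y`. Five signs
  -- multiply to `-1`, so `a × (b × (c × y))` equals its own negative and vanishes; the three
  -- factors are then cancelled one by one.
  rw [h1, h3, map_neg, LinearMap.neg_apply, h4, h5, map_neg, neg_neg, neg_neg,
    neg_eq_iff_add_eq_zero, ← two_smul ℝ, smul_eq_zero] at h2
  have h6 := h2.resolve_left two_ne_zero
  have h7 := eq_zero_of_cross_eq_zero ha0 (hbcy a ha) h6
  exact eq_zero_of_cross_eq_zero hc0 (hy c hc)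
    (eq_zero_of_cross_eq_zero hb0 (hcy b hb) h7)

/-! ### Weights of abelian groups of cross product automorphisms -/

section Weights

variable {H : Type*} [CommGroup H] (ρ : H →* (E7 ≃ₗ[ℝ] E7))

theorem rho_comm (h k : H) (x : E7) : ρ h (ρ k x) = ρ k (ρ h x) := by
  rw [← LinearEquiv.mul_apply, ← map_mul, mul_comm, map_mul, LinearEquiv.mul_apply]

/-- For a joint complex eigenvector `a + ib` with `a × b ≠ 0`, the vector `a × b` is scaled by the
squared modulus of the eigenvalue, which is 1. If `a × b = 0`, there is a real eigenline, on which
isometries act by signs and squares act trivially. -/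
theorem exists_fixed_of_square (hρ : ∀ h, PreservesCross (ρ h).toLinearMap)
    (hsq : ∀ h : H, ∃ k, h = k ^ 2) : ∃ u : E7, u ≠ 0 ∧ ∀ h, ρ h u = u := by
  have key : ∀ r : E7, r ≠ 0 → (∀ h, ∃ c : ℝ, ρ h r = c • r) → ∀ h, ρ h r = r := by
    intro r hr hc h
    obtain ⟨k, rfl⟩ := hsq h
    obtain ⟨c, hk⟩ := hc k
    have h1 := (hρ k).inner_map_map r r
    rw [hk, inner_smul_left, inner_smul_right, ← mul_assoc] at h1
    have h2 : c * c = 1 := by simpa [hr] using h1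
    rw [sq, map_mul, LinearEquiv.mul_apply, hk, map_smul, hk, smul_smul, h2, one_smul]
  -- Multiplication by `i` on the complexification, with `(a, b)` read as `a + ib`.
  let J : Module.End ℝ (E7 × E7) :=
    (-LinearMap.snd ℝ E7 E7).prod (LinearMap.fst ℝ E7 E7)
  obtain ⟨⟨a, b⟩, hv, hT⟩ := exists_joint_complex_eigenvector J
    (by ext x <;> simp [J])
    (fun h => (ρ h).toLinearMap.prodMap (ρ h).toLinearMap)
    (fun h k => by
      refine LinearMap.ext fun x => ?_
      simp [rho_comm ρ h k])
    (fun h => by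
      refine LinearMap.ext fun x => ?_
      simp [J])
  have hab : ∀ h, ∃ α β : ℝ, ρ h a = α • a - β • b ∧ ρ h b = α • b + β • a := by
    intro h
    obtain ⟨α, β, e⟩ := hT h
    refine ⟨α, β, ?_, ?_⟩
    · simpa [J, sub_eq_add_neg] using congrArg Prod.fst e
    · simpa [J] using congrArg Prod.snd e
  by_cases hc : cross a b = 0
  · rcases eq_or_ne a 0 with rfl | ha
    · have hb : b ≠ 0 := by
        rintro rfl
        exact hv rfl
      refine ⟨b, hb, key b hb fun h => ?_⟩
      obtain ⟨α, β, -, h2⟩ := hab h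
      exact ⟨α, by simpa using h2⟩
    · have h1 := cross_cross_self a b
      rw [hc, map_zero, eq_comm, sub_eq_zero] at h1
      have h0 : ⟪a, a⟫ ≠ 0 := inner_self_ne_zero.mpr ha
      have hb : b = (⟪a, a⟫⁻¹ * ⟪a, b⟫) • a := by
        rw [mul_smul, h1, smul_smul, inv_mul_cancel₀ h0, one_smul]
      refine ⟨a, ha, key a ha fun h => ?_⟩
      obtain ⟨α, β, h2, -⟩ := hab h
      refine ⟨α - β * (⟪a, a⟫⁻¹ * ⟪a, b⟫), ?_⟩
      rw [h2, sub_smul, mul_smul β, ← hb]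
  · refine ⟨cross a b, hc, fun h => ?_⟩
    obtain ⟨α, β, h1, h2⟩ := hab h
    have hn : α ^ 2 + β ^ 2 = 1 := by
      have e1 := (hρ h).inner_map_map a a
      have e2 := (hρ h).inner_map_map b b
      have hpos : ⟪a, a⟫ + ⟪b, b⟫ ≠ 0 := by
        have ha : a ≠ 0 := by
          rintro rfl
          simp at hc
        have := real_inner_self_pos.mpr ha
        have := real_inner_self_nonneg (x := b)
        positivity
      rw [h1] at e1
      rw [h2] at e2
      simp only [inner_add_left, inner_add_right, inner_sub_left, inner_sub_right,
        real_inner_smul_left, real_inner_smul_right, real_inner_comm a b] at e1 e2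
      apply mul_right_cancel₀ hpos
      linear_combination e1 + e2
    have hcr : cross (α • a - β • b) (α • b + β • a) = (α ^ 2 + β ^ 2) • cross a b := by
      simp only [map_add, map_sub, map_smul, LinearMap.sub_apply, LinearMap.smul_apply,
        cross_self, cross_anticomm b a]
      module
    rw [(hρ h).map_cross, h1, h2, hcr, hn, one_smul]

theorem exists_joint_eigenvector_of_finrank_lt (hρ : ∀ h, PreservesCross (ρ h).toLinearMap)
    {u : E7} (hu : ⟪u, u⟫ = 1) (hfix : ∀ h, ρ h u = u) (S : Submodule ℝ E7)
    (hS : Module.finrank ℝ S < 7) (huS : u ∈ S) (hJS : ∀ x ∈ S, cross u x ∈ S)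
    (hρS : ∀ h, ∀ x ∈ S, ρ h x ∈ S) :
    ∃ e ∈ Sᗮ, ⟪e, e⟫ = 1 ∧ ∀ h, ∃ a b : ℝ, ρ h e = a • e + b • cross u e := by
  have hbot : Sᗮ ≠ ⊥ := by
    intro h
    rw [Submodule.orthogonal_eq_bot_iff] at h
    rw [h, finrank_top, finrank_euclideanSpace_fin] at hS
    exact lt_irrefl _ hS
  obtain ⟨v, hvS, hv, hT⟩ := Submodule.exists_joint_complex_eigenvector hbot (cross u)
    (fun x hx y hy => by
      have := hx _ (hJS y hy)
      rw [inner_cross_right, this, neg_zero])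
    (fun x hx => by rw [cross_cross_self, hx u huS, hu]; simp)
    (fun h => (ρ h).toLinearMap)
    (fun h x hx y hy => by
      have := hx _ (hρS h⁻¹ y hy)
      rw [← (hρ h).inner_map_map, ← LinearEquiv.mul_apply, ← map_mul] at this
      simpa using this)
    (fun h k x => rho_comm ρ h k x)
    (fun h x => by
      have := (hρ h).map_cross u x
      rwa [hfix] at this)
  refine ⟨(‖v‖⁻¹ : ℝ) • v, Submodule.smul_mem _ _ hvS, ?_, fun h => ?_⟩
  · rw [real_inner_smul_left, real_inner_smul_right, real_inner_self_eq_norm_sq]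
    have := norm_ne_zero_iff.mpr hv
    field_simp
  · obtain ⟨a, b, hab⟩ := hT h
    refine ⟨a, b, ?_⟩
    rw [map_smul, map_smul]
    simp only [LinearEquiv.coe_coe] at hab
    rw [hab]
    module

variable [TopologicalSpace H]

theorem exists_character (hρ : ∀ h, PreservesCross (ρ h).toLinearMap)
    (hcont : ∀ x, Continuous fun h => ρ h x) {u e : E7} (hu : ⟪u, u⟫ = 1)
    (hfix : ∀ h, ρ h u = u) (he : ⟪e, e⟫ = 1) (hue : ⟪u, e⟫ = 0)
    (hspan : ∀ h, ∃ a b : ℝ, ρ h e = a • e + b • cross u e) :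
    ∃ χ : H →* Circle, Continuous χ ∧
      ∀ h, ρ h e = (χ h : ℂ).re • e + (χ h : ℂ).im • cross u e := by
  have hee : ⟪e, cross u e⟫ = 0 := inner_cross_self_right u e
  have hJJ : ⟪cross u e, cross u e⟫ = 1 := by rw [inner_cross_cross, hu, he, hue]; norm_num
  set z : H → ℂ := fun h => ⟨⟪ρ h e, e⟫, ⟪ρ h e, cross u e⟫⟩ with hz
  have hform : ∀ h, ρ h e = (z h).re • e + (z h).im • cross u e := by
    intro h
    obtain ⟨a, b, hab⟩ := hspan h
    have h1 : ⟪ρ h e, e⟫ = a := by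
      rw [hab, inner_add_left, real_inner_smul_left, real_inner_smul_left, he,
        real_inner_comm, hee]
      ring
    have h2 : ⟪ρ h e, cross u e⟫ = b := by
      rw [hab, inner_add_left, real_inner_smul_left, real_inner_smul_left, hJJ, hee]
      ring
    simp only [hz, h1, h2]
    exact hab
  have hJ : ∀ h, ρ h (cross u e) = (z h).re • cross u e - (z h).im • e := by
    intro h
    rw [(hρ h).map_cross, hfix, hform, map_add, map_smul, map_smul, cross_cross_self, hu, hue]
    module
  have hmul : ∀ h k, z (h * k) = z h * z k := by
    intro h k
    have h1 : ρ (h * k) e = (z h * z k).re • e + (z h * z k).im • cross u e := by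
      rw [map_mul, LinearEquiv.mul_apply, hform k, map_add, map_smul, map_smul, hform h, hJ h,
        Complex.mul_re, Complex.mul_im]
      module
    apply Complex.ext
    · change ⟪ρ (h * k) e, e⟫ = _
      rw [h1, inner_add_left, real_inner_smul_left, real_inner_smul_left, he, real_inner_comm,
        hee]
      ring
    · change ⟪ρ (h * k) e, cross u e⟫ = _
      rw [h1, inner_add_left, real_inner_smul_left, real_inner_smul_left, hJJ, hee]
      ring
  have hnorm : ∀ h, z h ∈ Submonoid.unitSphere ℂ := by
    intro h
    have h1 := (hρ h).inner_map_map e e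
    rw [hform h] at h1
    simp only [inner_add_left, inner_add_right, real_inner_smul_left, real_inner_smul_right, he,
      hJJ, hee, real_inner_comm e (cross u e)] at h1
    change z h ∈ Metric.sphere 0 1
    rw [mem_sphere_zero_iff_norm, ← pow_eq_one_iff_of_nonneg (norm_nonneg _) two_ne_zero,
      ← Complex.normSq_eq_norm_sq, Complex.normSq_apply]
    linarith
  have hone : z 1 = 1 := by
    apply Complex.ext
    · change ⟪ρ 1 e, e⟫ = 1
      rw [map_one]
      exact he
    · simp [hz, hee]
  refine ⟨⟨⟨fun h => ⟨z h, hnorm h⟩, Subtype.ext hone⟩, fun h k => Subtype.ext (hmul h k)⟩, ?_,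
    hform⟩
  refine Continuous.subtype_mk ?_ _
  have hzz : z = fun h => (⟪ρ h e, e⟫ : ℂ) + (⟪ρ h e, cross u e⟫ : ℂ) * Complex.I := by
    funext h
    exact Complex.mk_eq_add_mul_I _ _
  rw [hzz]
  have := hcont e
  fun_prop

/-- A joint eigenvector `f` orthogonal to `u`, `e` and `u × e` supplies the character; once `u`,
`e`, `f` are all fixed, rigidity applies. The third complex weight on the complement of `u` is thus
determined by the other two. -/
theorem exists_second_character (hρ : ∀ h, PreservesCross (ρ h).toLinearMap)
    (hcont : ∀ x, Continuous fun h => ρ h x) {u e : E7} (hu : ⟪u, u⟫ = 1)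
    (hfix : ∀ h, ρ h u = u) (he : ⟪e, e⟫ = 1) (hue : ⟪u, e⟫ = 0)
    (hspan : ∀ h, ∃ a b : ℝ, ρ h e = a • e + b • cross u e) :
    ∃ χ : H →* Circle, Continuous χ ∧ ∀ h, ρ h e = e → χ h = 1 → ρ h = 1 := by
  set S : Submodule ℝ E7 := Submodule.span ℝ (Set.range ![u, e, cross u e]) with hSdef
  have hSmem : ∀ x, x ∈ S ↔ ∃ a b c : ℝ, x = a • u + b • e + c • cross u e := by
    intro x
    rw [hSdef, Submodule.mem_span_range_iff_exists_fun]
    constructor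
    · rintro ⟨c, rfl⟩
      exact ⟨c 0, c 1, c 2, by simp [Fin.sum_univ_three]⟩
    · rintro ⟨a, b, c, rfl⟩
      exact ⟨![a, b, c], by simp [Fin.sum_univ_three]⟩
  have hJ : ∀ h x, ρ h (cross u x) = cross u (ρ h x) := by
    intro h x
    have := (hρ h).map_cross u x
    rwa [hfix] at this
  have huS : u ∈ S := (hSmem _).mpr ⟨1, 0, 0, by simp⟩
  have heS : e ∈ S := (hSmem _).mpr ⟨0, 1, 0, by simp⟩
  have hJeS : cross u e ∈ S := (hSmem _).mpr ⟨0, 0, 1, by simp⟩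
  have hJS : ∀ x ∈ S, cross u x ∈ S := by
    intro x hx
    obtain ⟨a, b, c, rfl⟩ := (hSmem x).mp hx
    refine (hSmem _).mpr ⟨0, -c, b, ?_⟩
    simp only [map_add, map_smul, cross_self, cross_cross_self, hu, hue]
    module
  have hρe : ∀ h, ρ h e ∈ S := by
    intro h
    obtain ⟨a, b, hab⟩ := hspan h
    exact (hSmem _).mpr ⟨0, a, b, by rw [hab]; module⟩
  obtain ⟨f, hfS, hf, hfspan⟩ := exists_joint_eigenvector_of_finrank_lt ρ hρ hu hfix S
    (lt_of_le_of_lt (finrank_range_le_card _) (by simp)) huS hJS (by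
      intro h x hx
      obtain ⟨a, b, c, rfl⟩ := (hSmem x).mp hx
      rw [map_add, map_add, map_smul, map_smul, map_smul, hfix, hJ]
      exact S.add_mem (S.add_mem (S.smul_mem _ huS) (S.smul_mem _ (hρe h)))
        (S.smul_mem _ (hJS _ (hρe h))))
  obtain ⟨χ, hχc, hχ⟩ := exists_character ρ hρ hcont hu hfix hf (hfS u huS) hfspan
  refine ⟨χ, hχc, fun h hhe hh => ?_⟩
  have hfh : ρ h f = f := by
    rw [hχ, hh]
    simp
  have ne_zero : ∀ x : E7, ⟪x, x⟫ = 1 → x ≠ 0 := by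
    rintro x hx rfl
    simp at hx
  exact (hρ h).eq_one_of_fixed (hfix h) hhe hfh (ne_zero u hu) (ne_zero e he) (ne_zero f hf) hue
    (hfS u huS) (hfS e heS) (hfS _ hJeS)

theorem exists_two_characters (hρ : ∀ h, PreservesCross (ρ h).toLinearMap)
    (hcont : ∀ x, Continuous fun h => ρ h x) {u : E7} (hu : ⟪u, u⟫ = 1)
    (hfix : ∀ h, ρ h u = u) :
    ∃ χ₁ χ₂ : H →* Circle, Continuous χ₁ ∧ Continuous χ₂ ∧
      ∀ h, χ₁ h = 1 → χ₂ h = 1 → ρ h = 1 := by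
  have hmem := Submodule.mem_span_singleton_self (R := ℝ) u
  obtain ⟨e, heS, he, hspan⟩ := exists_joint_eigenvector_of_finrank_lt ρ hρ hu hfix
    (Submodule.span ℝ {u}) (lt_of_le_of_lt (finrank_span_le_card _) (by simp)) hmem
    (fun x hx => by
      obtain ⟨c, rfl⟩ := Submodule.mem_span_singleton.mp hx
      simp [cross_self])
    (fun h x hx => by
      obtain ⟨c, rfl⟩ := Submodule.mem_span_singleton.mp hx
      rwa [map_smul, hfix])
  have hue : ⟪u, e⟫ = 0 := heS u hmem
  obtain ⟨χ₁, hc₁, h₁⟩ := exists_character ρ hρ hcont hu hfix he hue hspan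
  obtain ⟨χ₂, hc₂, h₂⟩ := exists_second_character ρ hρ hcont hu hfix he hue hspan
  refine ⟨χ₁, χ₂, hc₁, hc₂, fun h hh1 hh2 => h₂ h ?_ hh2⟩
  rw [h₁, hh1]
  simp

end Weights

end ToricG2

/-! ### Characters of closed subgroups of the torus -/

/-- A continuous homomorphism from a real topological vector space to the circle is the
exponential of a linear form. -/
theorem exists_linear_lift_circle {V : Type*} [NormedAddCommGroup V] [NormedSpace ℝ V]
    (f : V → Circle) (hf : Continuous f) (hadd : ∀ v w, f (v + w) = f v * f w) :
    ∃ Λ : V →L[ℝ] ℝ, ∀ v, f v = Circle.exp (Λ v) := by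
  have hf0 : f 0 = 1 := by
    have := hadd 0 0
    rw [add_zero] at this
    exact left_eq_mul.mp this
  obtain ⟨F, ⟨hF0, hF⟩, -⟩ := Circle.isCoveringMap_exp.existsUnique_continuousMap_lifts
    ⟨f, hf⟩ 0 0 (by simp [hf0])
  have hFf : ∀ v, Circle.exp (F v) = f v := fun v => congrFun hF v
  have huniq := Circle.isCoveringMap_exp.existsUnique_continuousMap_lifts
    (A := V) ⟨fun _ => 1, continuous_const⟩ 0 0 (by simp)
  have hFadd : ∀ v w, F (v + w) = F v + F w := by
    intro v w
    -- The additivity defect lifts the constant map 1 and vanishes at 0, so it is zero by uniqueness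
    -- of lifts.
    let G : C(V, ℝ) := ⟨fun x => F (v + x) - F v - F x, by fun_prop⟩
    have hG := huniq.unique (y₁ := G) (y₂ := ⟨fun _ => 0, continuous_const⟩)
      ⟨by simp [G, hF0], by
        funext x
        simp [G, Circle.exp_sub, hFf, hadd]⟩ ⟨rfl, by funext x; simp⟩
    have := congrArg (fun g : C(V, ℝ) => g w) hG
    simp only [G, ContinuousMap.coe_mk] at this
    linarith
  exact ⟨(AddMonoidHom.mk' F hFadd).toRealLinearMap F.continuous, fun v => (hFf v).symm⟩

namespace ToricG2

theorem continuous_expT3 : Continuous expT3 := by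
  unfold expT3
  fun_prop

/-- A logarithm on the torus. -/
noncomputable def logT3 (g : T3) : Fin 3 → ℝ :=
  ![(g.1 : ℂ).arg, (g.2.1 : ℂ).arg, (g.2.2 : ℂ).arg]

theorem expT3_logT3 (g : T3) : expT3 (logT3 g) = g := by
  simp [expT3, logT3]

theorem logT3_mem_Icc (g : T3) : logT3 g ∈ Set.Icc (fun _ => -Real.pi) (fun _ => Real.pi) := by
  constructor <;> intro i <;> fin_cases i <;>
    simp [logT3, Complex.arg_le_pi, (Complex.neg_pi_lt_arg _).le]

theorem continuousAt_logT3_one : ContinuousAt logT3 1 := by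
  have h : ContinuousAt (fun z : Circle => (z : ℂ).arg) 1 :=
    ContinuousAt.comp (f := fun z : Circle => (z : ℂ)) (g := Complex.arg)
      (Complex.continuousAt_arg (by simp)) (by fun_prop)
  refine continuousAt_pi.mpr fun i => ?_
  fin_cases i
  · exact ContinuousAt.comp (g := fun z : Circle => (z : ℂ).arg) (f := fun g : T3 => g.1) h
      (by fun_prop)
  · exact ContinuousAt.comp (g := fun z : Circle => (z : ℂ).arg) (f := fun g : T3 => g.2.1) h
      (by fun_prop)
  · exact ContinuousAt.comp (g := fun z : Circle => (z : ℂ).arg) (f := fun g : T3 => g.2.2) h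
      (by fun_prop)

theorem eq_zero_of_expT3_smul_eq_one {v : Fin 3 → ℝ} (h : ∀ t : ℝ, expT3 (t • v) = 1) :
    v = 0 := by
  have key : ∀ x : ℝ, (∀ t : ℝ, Circle.exp (t * x) = 1) → x = 0 := by
    intro x hx
    by_contra hx0
    have := hx (Real.pi / x)
    rw [div_mul_cancel₀ _ hx0] at this
    have := congrArg (fun z : Circle => (z : ℂ).re) this
    norm_num [Circle.coe_exp] at this
  ext i
  apply key
  intro t
  have := h t
  simp only [expT3, Prod.ext_iff, Prod.fst_one, Prod.snd_one, Pi.smul_apply, smul_eq_mul] at this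
  fin_cases i
  · exact this.1
  · exact this.2.1
  · exact this.2.2

/-- `Λ` is the differential of `χ`. It is injective because a vector in its kernel has a
one-parameter group killed by `χ`, hence trivial. -/
theorem exists_linear_lift {ι : Type*} [Fintype ι] (H : Subgroup T3) (χ : H →* (ι → Circle))
    (hχ : Continuous χ) (hinj : Function.Injective χ) :
    ∃ Λ : lieAlgebraOf H →ₗ[ℝ] (ι → ℝ), Function.Injective Λ ∧
      ∀ v, ∃ h : H, ∀ i, χ h i = Circle.exp (Λ v i) := by
  have hmem : ∀ v : lieAlgebraOf H, expT3 v ∈ H := fun v => by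
    have := v.2 1
    rwa [one_smul] at this
  let E : lieAlgebraOf H → H := fun v => ⟨expT3 v, hmem v⟩
  have hE : Continuous E := (continuous_expT3.comp continuous_subtype_val).subtype_mk _
  have hEadd : ∀ v w, E (v + w) = E v * E w := fun v w => Subtype.ext (expT3_add _ _)
  choose Λ hΛ using fun i => exists_linear_lift_circle (fun v => χ (E v) i)
    ((continuous_apply i).comp (hχ.comp hE)) (fun v w => by simp [hEadd])
  refine ⟨LinearMap.pi fun i => (Λ i).toLinearMap, ?_, fun v => ⟨E v, fun i => hΛ i v⟩⟩
  rw [← LinearMap.ker_eq_bot, LinearMap.ker_eq_bot']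
  intro v hv
  have h1 : ∀ t : ℝ, E (t • v) = 1 := by
    intro t
    apply hinj
    funext i
    have h2 : Λ i v = 0 := congrFun hv i
    have h3 : χ (E (t • v)) i = _ := hΛ i (t • v)
    rw [h3, map_smul, h2]
    simp
  exact Subtype.ext (eq_zero_of_expT3_smul_eq_one fun t => congrArg Subtype.val (h1 t))

theorem lieDim_le_card {ι : Type*} [Fintype ι] (H : Subgroup T3) (χ : H →* (ι → Circle))
    (hχ : Continuous χ) (hinj : Function.Injective χ) : lieDim H ≤ Fintype.card ι := by
  obtain ⟨Λ, hΛ, -⟩ := exists_linear_lift H χ hχ hinj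
  simpa [lieDim] using LinearMap.finrank_le_finrank_of_injective hΛ

/-- With equal dimensions the differential is onto, and the exponential of the target torus is onto,
so `χ` is a continuous bijection from a compact group to a Hausdorff one. -/
theorem nonempty_continuousMulEquiv {ι : Type*} [Fintype ι] (H : Subgroup T3)
    (hH : IsClosed (H : Set T3)) (χ : H →* (ι → Circle))
    (hχ : Continuous χ) (hinj : Function.Injective χ) (hdim : lieDim H = Fintype.card ι) :
    Nonempty (H ≃ₜ* (ι → Circle)) := by
  obtain ⟨Λ, hΛ, hex⟩ := exists_linear_lift H χ hχ hinj
  have hsurjΛ : Function.Surjective Λ :=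
    (LinearMap.injective_iff_surjective_of_finrank_eq_finrank (by simpa [lieDim] using hdim)).mp hΛ
  have hsurj : Function.Surjective χ := by
    intro z
    obtain ⟨v, hv⟩ := hsurjΛ fun i => (z i : ℂ).arg
    obtain ⟨h, hh⟩ := hex v
    refine ⟨h, funext fun i => ?_⟩
    rw [hh, hv, Circle.exp_arg]
  have : CompactSpace H := isCompact_iff_compactSpace.mp hH.isCompact
  let e := MulEquiv.ofBijective χ ⟨hinj, hsurj⟩
  have he : Continuous e := hχ
  exact ⟨{ e with
    continuous_toFun := he
    continuous_invFun := (Continuous.homeoOfEquivCompactToT2 (f := e.toEquiv) he).symm.continuous }⟩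

end ToricG2

open scoped Topology

namespace ToricG2

theorem contMDiff_expT3_comp {V : Type*} [NormedAddCommGroup V] [NormedSpace ℝ V]
    {f : V → Fin 3 → ℝ} (hf : ContDiff ℝ ∞ f) :
    ContMDiff 𝓘(ℝ, V) modelT3 ∞ (fun z => expT3 (f z)) := by
  have h : ∀ i, ContMDiff 𝓘(ℝ, V) (𝓡 1) ∞ (fun z => Circle.exp (f z i)) := fun i =>
    contMDiff_circleExp.comp (contDiff_pi.mp hf i).contMDiff
  exact (h 0).prodMk ((h 1).prodMk (h 2))

section Action

variable {M : Type*} [TopologicalSpace M] [ChartedSpace (EuclideanSpace ℝ (Fin 7)) M]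
  [MulAction T3 M]

/-! ### The action in a chart -/

/-- The action of `g` read in the chart at `p`. -/
noncomputable def chartSmul (p : M) (g : T3) (y : E7) : E7 :=
  extChartAt (𝓡 7) p (g • (extChartAt (𝓡 7) p).symm y)

/-- The action of the exponential of the first argument read in the chart at `p`. -/
noncomputable def chartExpSmul (p : M) (z : (Fin 3 → ℝ) × E7) : E7 := chartSmul p (expT3 z.1) z.2

theorem chartSmul_base {p : M} {g : T3} (hg : g • p = p) :
    chartSmul p g (extChartAt (𝓡 7) p p) = extChartAt (𝓡 7) p p := by
  rw [chartSmul, extChartAt_to_inv, hg]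

theorem chartSmul_chartSmul {p : M} (g h : T3) {y : E7}
    (hy : h • (extChartAt (𝓡 7) p).symm y ∈ (extChartAt (𝓡 7) p).source) :
    chartSmul p g (chartSmul p h y) = chartSmul p (g * h) y := by
  rw [chartSmul, chartSmul, PartialEquiv.left_inv _ hy, smul_smul, chartSmul]

/-- The derivative of the action of `g` at a fixed point `p`, read in the chart at `p`. -/
noncomputable def isotropyDeriv (p : M) (g : T3) : E7 →L[ℝ] E7 :=
  fderiv ℝ (chartSmul p g) (extChartAt (𝓡 7) p p)

theorem isotropyDeriv_one (p : M) : isotropyDeriv p 1 = ContinuousLinearMap.id ℝ E7 := by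
  refine ((hasFDerivAt_id _).congr_of_eventuallyEq ?_).fderiv
  filter_upwards [extChartAt_target_mem_nhds p] with y hy
  rw [chartSmul, one_smul, PartialEquiv.right_inv _ hy, id]

variable [ContMDiffSMul modelT3 (𝓡 7) ∞ T3 M]

theorem mfderiv_smul_eq {p : M} {g : T3} (hg : g • p = p) :
    (mfderiv (𝓡 7) (𝓡 7) (fun x : M => g • x) p : E7 →L[ℝ] E7) = isotropyDeriv p g := by
  have hmd : MDifferentiableAt (𝓡 7) (𝓡 7) (fun x : M => g • x) p := by
    have h1 : ContMDiff (𝓡 7) modelT3 ∞ (fun _ : M => g) := contMDiff_const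
    exact ((h1.contMDiffAt (x := p)).smul contMDiffAt_id).mdifferentiableAt (by simp)
  rw [hmd.mfderiv]
  simp only [modelWithCornersSelf_coe, Set.range_id, fderivWithin_univ]
  simp only [writtenInExtChartAt, hg]
  rfl

theorem continuousSMul_T3 : ContinuousSMul T3 M :=
  ⟨(contMDiff_smul (I := modelT3) (I' := 𝓡 7) (n := ∞)).continuous⟩

theorem eventually_smul_mem_source {p : M} {g : T3} (hg : g • p = p) :
    ∀ᶠ y in 𝓝 (extChartAt (𝓡 7) p p),
      g • (extChartAt (𝓡 7) p).symm y ∈ (extChartAt (𝓡 7) p).source := by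
  have := continuousSMul_T3 (M := M)
  have h : ContinuousAt (fun y => g • (extChartAt (𝓡 7) p).symm y) (extChartAt (𝓡 7) p p) :=
    (continuousAt_extChartAt_symm p).const_smul g
  refine h.eventually_mem ?_
  rw [extChartAt_to_inv, hg]
  exact extChartAt_source_mem_nhds p

variable [IsManifold (𝓡 7) ∞ M]

theorem contDiffAt_chartExpSmul {p : M} {v : Fin 3 → ℝ} {y : E7}
    (hy : y ∈ (extChartAt (𝓡 7) p).target)
    (hv : expT3 v • (extChartAt (𝓡 7) p).symm y ∈ (extChartAt (𝓡 7) p).source) :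
    ContDiffAt ℝ ∞ (chartExpSmul p) (v, y) := by
  rw [← contMDiffAt_iff_contDiffAt]
  have h1 : ContMDiffAt 𝓘(ℝ, (Fin 3 → ℝ) × E7) modelT3 ∞
      (fun z : (Fin 3 → ℝ) × E7 => expT3 z.1) (v, y) :=
    contMDiff_expT3_comp contDiff_fst _
  have h2 : ContMDiffAt 𝓘(ℝ, (Fin 3 → ℝ) × E7) (𝓡 7) ∞
      (fun z : (Fin 3 → ℝ) × E7 => (extChartAt (𝓡 7) p).symm z.2) (v, y) :=
    ContMDiffAt.comp (I' := 𝓘(ℝ, E7)) (v, y)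
      ((contMDiffOn_extChartAt_symm p).contMDiffAt
        ((isOpen_extChartAt_target p).mem_nhds hy)) contDiff_snd.contMDiff.contMDiffAt
  have h3 := h1.smul h2
  rw [extChartAt_source] at hv
  exact (contMDiffAt_extChartAt' hv).comp (v, y) h3

theorem contDiffAt_chartExpSmul_base {p : M} {v : Fin 3 → ℝ} (hv : expT3 v • p = p) :
    ContDiffAt ℝ ∞ (chartExpSmul p) (v, extChartAt (𝓡 7) p p) := by
  refine contDiffAt_chartExpSmul (mem_extChartAt_target p) ?_
  rw [extChartAt_to_inv, hv]
  exact mem_extChartAt_source p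

theorem fderiv_chartExpSmul_right {p : M} {v : Fin 3 → ℝ} (hv : expT3 v • p = p) :
    HasFDerivAt (chartSmul p (expT3 v))
      ((fderiv ℝ (chartExpSmul p) (v, extChartAt (𝓡 7) p p)).comp
        (ContinuousLinearMap.inr ℝ (Fin 3 → ℝ) E7)) (extChartAt (𝓡 7) p p) :=
  HasFDerivAt.comp (f := fun y : E7 => (v, y)) (extChartAt (𝓡 7) p p)
    ((contDiffAt_chartExpSmul_base hv).differentiableAt (by simp)).hasFDerivAt
    (hasFDerivAt_prodMk_right v _)

theorem contDiffAt_chartSmul {p : M} {g : T3} (hg : g • p = p) :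
    ContDiffAt ℝ ∞ (chartSmul p g) (extChartAt (𝓡 7) p p) := by
  rw [← expT3_logT3 g] at hg ⊢
  exact ContDiffAt.comp (f := fun y : E7 => (logT3 g, y)) (extChartAt (𝓡 7) p p)
    (contDiffAt_chartExpSmul_base hg) (by fun_prop)

theorem hasFDerivAt_chartSmul {p : M} {g : T3} (hg : g • p = p) :
    HasFDerivAt (chartSmul p g) (isotropyDeriv p g) (extChartAt (𝓡 7) p p) :=
  ((contDiffAt_chartSmul hg).differentiableAt (by simp)).hasFDerivAt

theorem isotropyDeriv_expT3 {p : M} {v : Fin 3 → ℝ} (hv : expT3 v • p = p) :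
    isotropyDeriv p (expT3 v) = (fderiv ℝ (chartExpSmul p) (v, extChartAt (𝓡 7) p p)).comp
        (ContinuousLinearMap.inr ℝ (Fin 3 → ℝ) E7) :=
  (fderiv_chartExpSmul_right hv).fderiv

theorem isotropyDeriv_mul {p : M} {g h : T3} (hg : g • p = p) (hh : h • p = p) :
    isotropyDeriv p (g * h) = (isotropyDeriv p g).comp (isotropyDeriv p h) := by
  have h1 : HasFDerivAt (chartSmul p g) (isotropyDeriv p g)
      (chartSmul p h (extChartAt (𝓡 7) p p)) := by
    rw [chartSmul_base hh]
    exact hasFDerivAt_chartSmul hg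
  have h2 := h1.comp _ (hasFDerivAt_chartSmul hh)
  refine (h2.congr_of_eventuallyEq ?_).fderiv
  filter_upwards [eventually_smul_mem_source hh] with y hy
  exact (chartSmul_chartSmul g h hy).symm

theorem continuousAt_fderiv_chartExpSmul {p : M} {v : Fin 3 → ℝ} (hv : expT3 v • p = p) :
    ContinuousAt (fun w => (fderiv ℝ (chartExpSmul p) (w, extChartAt (𝓡 7) p p)).comp
        (ContinuousLinearMap.inr ℝ (Fin 3 → ℝ) E7)) v := by
  have h := ((contDiffAt_chartExpSmul_base hv).fderiv_right (m := 0) (by simp)).continuousAt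
  have h2 : ContinuousAt
      (fun w => fderiv ℝ (chartExpSmul p) (w, extChartAt (𝓡 7) p p)) v :=
    ContinuousAt.comp (f := fun w => (w, extChartAt (𝓡 7) p p)) h (by fun_prop)
  exact h2.clm_comp continuousAt_const

/-! ### Fundamental vector fields -/

/-- The velocities at `p` of the one-parameter groups, read in the chart at `p`. -/
noncomputable def velocity (p : M) : (Fin 3 → ℝ) →L[ℝ] E7 :=
  (fderiv ℝ (chartExpSmul p) (0, extChartAt (𝓡 7) p p)).comp
    (ContinuousLinearMap.inl ℝ (Fin 3 → ℝ) E7)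

theorem hasFDerivAt_velocity (p : M) :
    HasFDerivAt (fun v => extChartAt (𝓡 7) p (expT3 v • p)) (velocity p) 0 := by
  have h0 : expT3 0 • p = p := by rw [expT3_zero, one_smul]
  have h := HasFDerivAt.comp (f := fun v : Fin 3 → ℝ => (v, extChartAt (𝓡 7) p p)) 0
    ((contDiffAt_chartExpSmul_base h0).differentiableAt (by simp)).hasFDerivAt
    (hasFDerivAt_prodMk_left _ _)
  refine h.congr_of_eventuallyEq (Filter.Eventually.of_forall fun v => ?_)
  simp [chartExpSmul, chartSmul]

theorem hasDerivAt_velocity (p : M) (v : Fin 3 → ℝ) :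
    HasDerivAt (fun t : ℝ => extChartAt (𝓡 7) p (expT3 (t • v) • p)) (velocity p v) 0 := by
  have h1 : HasDerivAt (fun t : ℝ => t • v) v 0 := by
    simpa using (hasDerivAt_id (0 : ℝ)).smul_const v
  have h2 := hasFDerivAt_velocity p
  rw [← zero_smul ℝ v] at h2
  exact h2.comp_hasDerivAt (0 : ℝ) h1

theorem fundamental_eq_velocity (p : M) (v : Fin 3 → ℝ) :
    (fundamental v p : E7) = velocity p v := by
  have h0 : expT3 ((0 : ℝ) • v) • p = p := by rw [zero_smul, expT3_zero, one_smul]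
  have hmd : MDifferentiableAt 𝓘(ℝ, ℝ) (𝓡 7) (fun t : ℝ => expT3 (t • v) • p) 0 := by
    have h1 : ContMDiff 𝓘(ℝ, ℝ) modelT3 ∞ (fun t : ℝ => expT3 (t • v)) :=
      contMDiff_expT3_comp (by fun_prop)
    exact ((h1.contMDiffAt (x := 0)).smul contMDiffAt_const).mdifferentiableAt (by simp)
  rw [fundamental, hmd.mfderiv]
  simp only [modelWithCornersSelf_coe, Set.range_id, fderivWithin_univ]
  simp only [writtenInExtChartAt, h0]
  exact (hasDerivAt_velocity p v).deriv

/-- Since the torus is abelian, `g` commutes with `expT3 (t • v)` and so fixes the orbit curve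
through `p` pointwise. -/
theorem isotropyDeriv_velocity {p : M} {g : T3} (hg : g • p = p) (v : Fin 3 → ℝ) :
    isotropyDeriv p g (velocity p v) = velocity p v := by
  have := continuousSMul_T3 (M := M)
  have h0 : expT3 ((0 : ℝ) • v) • p = p := by rw [zero_smul, expT3_zero, one_smul]
  have h1 : HasFDerivAt (chartSmul p g) (isotropyDeriv p g)
      (extChartAt (𝓡 7) p (expT3 ((0 : ℝ) • v) • p)) := by
    rw [h0]
    exact hasFDerivAt_chartSmul hg
  have h2 := h1.comp_hasDerivAt (0 : ℝ) (hasDerivAt_velocity p v)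
  refine h2.unique ((hasDerivAt_velocity p v).congr_of_eventuallyEq ?_)
  have hc : ContinuousAt (fun t : ℝ => expT3 (t • v) • p) 0 := by
    have := continuous_expT3
    fun_prop
  have hs : ∀ᶠ t : ℝ in 𝓝 0, expT3 (t • v) • p ∈ (extChartAt (𝓡 7) p).source :=
    hc.eventually_mem (by rw [h0]; exact extChartAt_source_mem_nhds p)
  filter_upwards [hs] with t ht
  simp only [Function.comp_apply, chartSmul]
  rw [PartialEquiv.left_inv _ ht, smul_comm, hg]

/-- A zero velocity at time 0 is carried by `expT3 (s • v)` to a zero velocity at time `s`. The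
curve is thus constant for small times, and taking powers reaches all times. -/
theorem velocity_eq_zero_iff {p : M} {v : Fin 3 → ℝ} :
    velocity p v = 0 ↔ v ∈ lieAlgebraOf (MulAction.stabilizer T3 p) := by
  constructor
  · intro hv
    have := continuousSMul_T3 (M := M)
    have h0 : expT3 ((0 : ℝ) • v) • p = p := by rw [zero_smul, expT3_zero, one_smul]
    set ψ := extChartAt (𝓡 7) p with hψ
    have hc : Continuous (fun t : ℝ => expT3 (t • v) • p) := by
      have := continuous_expT3
      fun_prop
    have hs : ∀ᶠ t : ℝ in 𝓝 0, expT3 (t • v) • p ∈ ψ.source :=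
      hc.continuousAt.eventually_mem (by rw [h0]; exact extChartAt_source_mem_nhds p)
    have hderiv : ∀ s : ℝ, expT3 (s • v) • p ∈ ψ.source →
        HasDerivAt (fun t : ℝ => ψ (expT3 (t • v) • p)) 0 s := by
      intro s hsrc
      have hG : DifferentiableAt ℝ (chartSmul p (expT3 (s • v))) (ψ p) := by
        have h1 : ContDiffAt ℝ ∞ (chartExpSmul p) (s • v, ψ p) :=
          contDiffAt_chartExpSmul (mem_extChartAt_target p) (by rwa [extChartAt_to_inv])
        exact DifferentiableAt.comp (f := fun y : E7 => (s • v, y)) (ψ p)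
          (h1.differentiableAt (by simp)) (by fun_prop)
      have h1 : HasFDerivAt (chartSmul p (expT3 (s • v)))
          (fderiv ℝ (chartSmul p (expT3 (s • v))) (ψ p)) (ψ (expT3 ((0 : ℝ) • v) • p)) := by
        rw [h0]
        exact hG.hasFDerivAt
      have h2 := h1.comp_hasDerivAt (0 : ℝ) (hasDerivAt_velocity p v)
      rw [hv, map_zero] at h2
      have h3 : HasDerivAt (fun r : ℝ => ψ (expT3 ((s + r) • v) • p)) 0 0 := by
        refine h2.congr_of_eventuallyEq ?_
        filter_upwards [hs] with r hr
        simp only [Function.comp_apply, chartSmul]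
        rw [PartialEquiv.left_inv _ hr, smul_smul, ← expT3_add, ← add_smul]
      have h4 := HasDerivAt.comp_sub_const s s (by simpa using h3)
      simpa using h4
    obtain ⟨ε, hε, hball⟩ := Metric.eventually_nhds_iff.mp hs
    have hsmall : ∀ t : ℝ, |t| < ε → expT3 (t • v) • p = p := by
      intro t ht
      have hconst := (convex_ball (0 : ℝ) ε).is_const_of_fderivWithin_eq_zero (𝕜 := ℝ)
        (f := fun t : ℝ => ψ (expT3 (t • v) • p))
        (fun s hs => (hderiv s (hball hs)).differentiableAt.differentiableWithinAt)
        (fun s hs => by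
          rw [fderivWithin_of_isOpen Metric.isOpen_ball hs]
          rw [(hderiv s (hball hs)).hasFDerivAt.fderiv]
          simp)
        (x := t) (y := 0) (by simpa using ht) (by simpa using hε)
      have h5 := ψ.injOn (hball (by simpa using ht)) (hball (by simpa using hε)) hconst
      rw [h5, h0]
    intro t
    obtain ⟨n, hn⟩ := exists_nat_gt (|t| / ε)
    have hn0 : (0 : ℝ) < n := lt_of_le_of_lt (by positivity) hn
    have h6 : expT3 ((t / n) • v) ∈ MulAction.stabilizer T3 p := by
      refine hsmall _ ?_
      rw [abs_div, abs_of_pos hn0, div_lt_iff₀ hn0]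
      rwa [div_lt_iff₀ hε, mul_comm] at hn
    have hpow : ∀ (k : ℕ) (w : Fin 3 → ℝ), expT3 ((k : ℝ) • w) = expT3 w ^ k := by
      intro k w
      induction k with
      | zero => simp [expT3_zero]
      | succ k ih =>
        rw [Nat.cast_succ, add_smul, one_smul, expT3_add, ih, pow_succ]
    have h7 := pow_mem h6 n
    rwa [← hpow, smul_smul, mul_div_cancel₀ _ hn0.ne'] at h7
  · intro hv
    refine (hasDerivAt_velocity p v).unique ?_
    have : (fun t : ℝ => extChartAt (𝓡 7) p (expT3 (t • v) • p))
        = fun _ => extChartAt (𝓡 7) p p := by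
      funext t
      rw [show expT3 (t • v) • p = p from hv t]
    rw [this]
    exact hasDerivAt_const _ _

end Action

end ToricG2

namespace ToricG2

section Action

variable {M : Type*} [TopologicalSpace M] [ChartedSpace (EuclideanSpace ℝ (Fin 7)) M]
  [MulAction T3 M] [ContMDiffSMul modelT3 (𝓡 7) ∞ T3 M]

/-! ### Faithfulness of the isotropy representation -/

theorem isClosed_fixedBy [T2Space M] (g : T3) : IsClosed {x : M | g • x = x} := by
  have := continuousSMul_T3 (M := M)
  exact isClosed_eq (by fun_prop) continuous_id

theorem isClosed_stabilizer_T3 [T2Space M] (p : M) : IsClosed (MulAction.stabilizer T3 p : Set T3) := by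
  have := continuousSMul_T3 (M := M)
  exact isClosed_eq (f := fun g : T3 => g • p) (by fun_prop) continuous_const

variable [IsManifold (𝓡 7) ∞ M]

theorem isotropyDeriv_pow {p : M} {g : T3} (hg : g • p = p)
    (hd : isotropyDeriv p g = ContinuousLinearMap.id ℝ E7) (n : ℕ) :
    g ^ n • p = p ∧ isotropyDeriv p (g ^ n) = ContinuousLinearMap.id ℝ E7 := by
  induction n with
  | zero => exact ⟨by simp, by rw [pow_zero, isotropyDeriv_one]⟩
  | succ n ih =>
    refine ⟨by rw [pow_succ, mul_smul, hg, ih.1], ?_⟩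
    rw [pow_succ, isotropyDeriv_mul ih.1 hg, ih.2, hd]
    rfl

section T2

variable [T2Space M]

/-- The logarithms in a compact box of the elements that fix `p` to first order. -/
def firstOrderKernel (p : M) : Set (Fin 3 → ℝ) :=
  {v ∈ Set.Icc (fun _ => -Real.pi) (fun _ => Real.pi) |
    expT3 v • p = p ∧ isotropyDeriv p (expT3 v) = ContinuousLinearMap.id ℝ E7}

theorem isCompact_firstOrderKernel (p : M) : IsCompact (firstOrderKernel p) := by
  have := continuousSMul_T3 (M := M)
  have := continuous_expT3
  set K : Set (Fin 3 → ℝ) :=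
    Set.Icc (fun _ => -Real.pi) (fun _ => Real.pi) ∩ {v | expT3 v • p = p} with hK
  have hKc : IsClosed K :=
    isClosed_Icc.inter (isClosed_eq (f := fun v => expT3 v • p) (by fun_prop) continuous_const)
  have hcont : ContinuousOn (fun w =>
      (fderiv ℝ (chartExpSmul p) (w, extChartAt (𝓡 7) p p)).comp
        (ContinuousLinearMap.inr ℝ (Fin 3 → ℝ) E7)) K := fun v hv =>
    (continuousAt_fderiv_chartExpSmul hv.2).continuousWithinAt
  have h := hcont.preimage_isClosed_of_isClosed hKc
    (isClosed_singleton (x := ContinuousLinearMap.id ℝ E7))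
  refine isCompact_Icc.of_isClosed_subset ?_ (Set.sep_subset _ _)
  convert h using 1
  ext v
  constructor
  · rintro ⟨h1, h2, h3⟩
    exact ⟨⟨h1, h2⟩, by rw [isotropyDeriv_expT3 h2] at h3; exact h3⟩
  · rintro ⟨⟨h1, h2⟩, h3⟩
    exact ⟨h1, h2, by rw [isotropyDeriv_expT3 h2]; exact h3⟩

/-- Strict differentiability, jointly in the logarithm and the point, gives the estimate near each
`v`; compactness of the kernel makes it uniform, hence valid for all iterates of an element at once.
-/
theorem eventually_norm_sub_le (p : M) :
    ∀ᶠ q : E7 × E7 in 𝓝 (extChartAt (𝓡 7) p p, extChartAt (𝓡 7) p p),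
      ∀ v ∈ firstOrderKernel p, ‖chartSmul p (expT3 v) q.1 - chartSmul p (expT3 v) q.2
        - (q.1 - q.2)‖ ≤ 1 / 2 * ‖q.1 - q.2‖ := by
  refine (isCompact_firstOrderKernel p).eventually_forall_of_forall_eventually
    (P := fun (q : E7 × E7) v => ‖chartSmul p (expT3 v) q.1 - chartSmul p (expT3 v) q.2
        - (q.1 - q.2)‖ ≤ 1 / 2 * ‖q.1 - q.2‖) ?_
  rintro v ⟨-, hv, hd⟩
  rw [isotropyDeriv_expT3 hv] at hd
  have hs := ((contDiffAt_chartExpSmul_base hv).hasStrictFDerivAt (by simp)).isLittleO.def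
    (c := 1 / 2) (by norm_num)
  have ht : Filter.Tendsto (fun z : (E7 × E7) × (Fin 3 → ℝ) => ((z.2, z.1.1), (z.2, z.1.2)))
      (𝓝 ((extChartAt (𝓡 7) p p, extChartAt (𝓡 7) p p), v))
      (𝓝 ((v, extChartAt (𝓡 7) p p), (v, extChartAt (𝓡 7) p p))) := by
    apply Continuous.tendsto' _ _ _ rfl
    fun_prop
  filter_upwards [ht.eventually hs] with z hz
  have h1 : ∀ y, fderiv ℝ (chartExpSmul p) (v, extChartAt (𝓡 7) p p) (0, y) = y := fun y =>
    congrArg (fun f => f y) hd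
  simp only [Prod.mk_sub_mk, sub_self, h1, chartExpSmul, Prod.norm_mk, norm_zero] at hz
  rwa [max_eq_right (norm_nonneg _)] at hz

/-- The iterates of `g` stay close to the identity to first order, so the displacement of a
point near `p`, multiplied by the number of iterations, stays bounded. -/
theorem eventually_chartSmul_eq {p : M} {g : T3} (hg : g • p = p)
    (hd : isotropyDeriv p g = ContinuousLinearMap.id ℝ E7) :
    ∀ᶠ y in 𝓝 (extChartAt (𝓡 7) p p), chartSmul p g y = y := by
  set y₀ := extChartAt (𝓡 7) p p with hy₀
  have hcont : ContinuousAt (chartSmul p g) y₀ := (contDiffAt_chartSmul hg).continuousAt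
  have hA : Filter.Tendsto (fun y => (chartSmul p g y, y)) (𝓝 y₀) (𝓝 (y₀, y₀)) := by
    have := hcont.tendsto
    rw [chartSmul_base hg] at this
    exact this.prodMk_nhds Filter.tendsto_id
  have hB : Filter.Tendsto (fun y => (y, y₀)) (𝓝 y₀) (𝓝 (y₀, y₀)) :=
    Continuous.tendsto' (by fun_prop) _ _ rfl
  filter_upwards [hA.eventually (eventually_norm_sub_le p), hB.eventually
    (eventually_norm_sub_le p), eventually_smul_mem_source hg] with y h1 h2 hsrc
  set d := chartSmul p g y - y with hdd
  have hpow := isotropyDeriv_pow hg hd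
  have hmem : ∀ n, logT3 (g ^ n) ∈ firstOrderKernel p := fun n =>
    ⟨logT3_mem_Icc _, by rw [expT3_logT3]; exact hpow n⟩
  have hstep : ∀ n, ‖chartSmul p (g ^ (n + 1)) y - chartSmul p (g ^ n) y - d‖ ≤ 1 / 2 * ‖d‖ := by
    intro n
    have := h1 _ (hmem n)
    rwa [expT3_logT3, chartSmul_chartSmul _ _ hsrc, ← pow_succ] at this
  have hbound : ∀ n, ‖chartSmul p (g ^ n) y - y‖ ≤ 1 / 2 * ‖y - y₀‖ := by
    intro n
    have h := h2 _ (hmem n)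
    simp only [expT3_logT3] at h
    rw [chartSmul_base (hpow n).1] at h
    rwa [sub_sub_sub_cancel_right] at h
  have hsum : ∀ n : ℕ, ‖chartSmul p (g ^ n) y - chartSmul p (g ^ 0) y - (n : ℝ) • d‖
      ≤ n * (1 / 2 * ‖d‖) := by
    intro n
    induction n with
    | zero => simp
    | succ n ih =>
      have e : chartSmul p (g ^ (n + 1)) y - chartSmul p (g ^ 0) y - ((n + 1 : ℕ) : ℝ) • d
          = (chartSmul p (g ^ (n + 1)) y - chartSmul p (g ^ n) y - d)
            + (chartSmul p (g ^ n) y - chartSmul p (g ^ 0) y - (n : ℝ) • d) := by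
        push_cast
        module
      rw [e]
      refine (norm_add_le _ _).trans ((add_le_add (hstep n) ih).trans_eq ?_)
      push_cast
      ring
  -- The right side collects two bounds of `1 / 2 * ‖y - y₀‖`, one for `g ^ n` and one for `g ^ 0`.
  have hlin : ∀ n : ℕ, n * (1 / 2 * ‖d‖) ≤ ‖y - y₀‖ := by
    intro n
    have e : (n : ℝ) • d = (chartSmul p (g ^ n) y - y) - (chartSmul p (g ^ 0) y - y)
        - (chartSmul p (g ^ n) y - chartSmul p (g ^ 0) y - (n : ℝ) • d) := by module
    have h3 : ‖(n : ℝ) • d‖ ≤ _ := (congrArg norm e).trans_le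
      ((norm_sub_le _ _).trans (add_le_add (norm_sub_le _ _) le_rfl))
    rw [norm_smul, Real.norm_natCast] at h3
    linarith [hbound n, hbound 0, hsum n]
  by_contra hne
  have hd0 : 0 < ‖d‖ := norm_pos_iff.mpr (sub_ne_zero.mpr hne)
  obtain ⟨n, hn⟩ := exists_nat_gt (‖y - y₀‖ / (1 / 2 * ‖d‖))
  rw [div_lt_iff₀ (by positivity)] at hn
  exact absurd (hlin n) (not_le.mpr hn)

theorem eventually_smul_eq {p : M} {g : T3} (hg : g • p = p)
    (hd : isotropyDeriv p g = ContinuousLinearMap.id ℝ E7) : ∀ᶠ x in 𝓝 p, g • x = x := by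
  have := continuousSMul_T3 (M := M)
  have hsrc : ∀ᶠ x in 𝓝 p, g • x ∈ (extChartAt (𝓡 7) p).source := by
    have : ContinuousAt (fun x : M => g • x) p := by fun_prop
    exact this.eventually_mem (by rw [hg]; exact extChartAt_source_mem_nhds p)
  filter_upwards [(continuousAt_extChartAt (I := 𝓡 7) p).eventually (eventually_chartSmul_eq hg hd),
    extChartAt_source_mem_nhds (I := 𝓡 7) p, hsrc] with x h1 h2 h3
  rw [chartSmul, PartialEquiv.left_inv _ h2] at h1
  exact (extChartAt (𝓡 7) p).injOn h3 h2 h1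

theorem isotropyDeriv_eq_id_of_mem_closure {q : M} {g : T3}
    (hq : q ∈ closure (interior {x : M | g • x = x})) :
    isotropyDeriv q g = ContinuousLinearMap.id ℝ E7 := by
  set U := interior {x : M | g • x = x} with hU
  have hgq : g • q = q := closure_minimal interior_subset (isClosed_fixedBy g) hq
  set ψ := extChartAt (𝓡 7) q with hψ
  have hcd : ContinuousAt (fderiv ℝ (chartSmul q g)) (ψ q) :=
    ((contDiffAt_chartSmul hgq).fderiv_right (m := 0) (by simp)).continuousAt
  have hcx : Filter.Tendsto (fun x => fderiv ℝ (chartSmul q g) (ψ x)) (𝓝 q)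
      (𝓝 (isotropyDeriv q g)) := hcd.tendsto.comp (continuousAt_extChartAt q).tendsto
  have hfreq : ∃ᶠ x in 𝓝 q, x ∈ U := mem_closure_iff_frequently.mp hq
  refine isClosed_singleton.mem_of_frequently_of_tendsto
    ((hfreq.and_eventually (extChartAt_source_mem_nhds (I := 𝓡 7) q)).mono ?_) hcx
  rintro x ⟨hxU, hxs⟩
  have hψx : ψ x ∈ ψ.target := ψ.map_source hxs
  have hsymm : ContinuousAt ψ.symm (ψ x) := continuousAt_extChartAt_symm'' hψx
  have hUx : ∀ᶠ y in 𝓝 (ψ x), ψ.symm y ∈ U :=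
    hsymm.eventually_mem (by rw [ψ.left_inv hxs]; exact isOpen_interior.mem_nhds hxU)
  refine ((hasFDerivAt_id _).congr_of_eventuallyEq ?_).fderiv
  filter_upwards [hUx, (isOpen_extChartAt_target q).mem_nhds hψx] with y hyU hyt
  have hfix : ψ.symm y ∈ {x : M | g • x = x} := interior_subset hyU
  have : g • ψ.symm y = ψ.symm y := hfix
  rw [chartSmul, ← hψ, this, ψ.right_inv hyt, id]

/-- The interior of the fixed set of `g` is closed: at a limit point the derivative is the identity
by continuity, so `g` fixes a neighbourhood. -/
theorem eq_one_of_isotropyDeriv_eq_id [ConnectedSpace M] [FaithfulSMul T3 M] {p : M} {g : T3}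
    (hg : g • p = p) (hd : isotropyDeriv p g = ContinuousLinearMap.id ℝ E7) : g = 1 := by
  set U := interior {x : M | g • x = x} with hU
  have hclosed : IsClosed U := by
    refine isClosed_of_closure_subset fun q hq => ?_
    exact mem_interior_iff_mem_nhds.mpr (eventually_smul_eq
      (closure_minimal interior_subset (isClosed_fixedBy g) hq)
      (isotropyDeriv_eq_id_of_mem_closure hq))
  have hne : U.Nonempty := ⟨p, mem_interior_iff_mem_nhds.mpr (eventually_smul_eq hg hd)⟩
  have huniv : U = Set.univ := IsClopen.eq_univ ⟨hclosed, isOpen_interior⟩ hne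
  refine eq_of_smul_eq_smul (α := M) fun x => ?_
  rw [one_smul]
  have hx : x ∈ U := by
    rw [huniv]
    exact Set.mem_univ x
  have hfix : x ∈ {x : M | g • x = x} := interior_subset hx
  exact hfix

end T2

/-! ### The isotropy representation -/

/-- The isotropy representation of the stabilizer of `p` in the chart at `p`. -/
noncomputable def isotropyHom (p : M) : MulAction.stabilizer T3 p →* (E7 →L[ℝ] E7) where
  toFun h := isotropyDeriv p h
  map_one' := isotropyDeriv_one p
  map_mul' g h := isotropyDeriv_mul g.2 h.2

/-- For a homomorphism continuity at 1 suffices, and there the logarithm is continuous. -/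
theorem continuous_isotropyHom (p : M) : Continuous (isotropyHom p) := by
  refine continuous_of_continuousAt_one _ ?_
  have h0 : expT3 (logT3 1) • p = p := by rw [expT3_logT3, one_smul]
  have h1 : ContinuousAt (fun h : MulAction.stabilizer T3 p => logT3 h) 1 :=
    ContinuousAt.comp (f := fun h : MulAction.stabilizer T3 p => (h : T3)) (g := logT3)
      continuousAt_logT3_one continuous_subtype_val.continuousAt
  have h2 := ContinuousAt.comp (f := fun h : MulAction.stabilizer T3 p => logT3 h) (x := 1)
    (continuousAt_fderiv_chartExpSmul h0) h1
  refine h2.congr (Filter.Eventually.of_forall fun h => ?_)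
  have h3 : expT3 (logT3 h) • p = p := by
    rw [expT3_logT3]
    exact h.2
  have h4 := isotropyDeriv_expT3 h3
  rw [expT3_logT3] at h4
  exact h4.symm

/-- The isotropy representation conjugated by a linear automorphism of the model space. -/
noncomputable def isotropyRep (p : M) (ℓ : E7 ≃ₗ[ℝ] E7) :
    MulAction.stabilizer T3 p →* (E7 ≃ₗ[ℝ] E7) :=
  (LinearMap.GeneralLinearGroup.generalLinearEquiv ℝ E7).toMonoidHom.comp <|
    MonoidHom.toHomUnits
      { toFun := fun h =>
          ℓ.symm.toLinearMap ∘ₗ (isotropyHom p h).toLinearMap ∘ₗ ℓ.toLinearMap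
        map_one' := by
          ext1 x
          simp
        map_mul' := fun g h => by
          ext1 x
          simp }

theorem isotropyRep_apply (p : M) (ℓ : E7 ≃ₗ[ℝ] E7) (h : MulAction.stabilizer T3 p) (x : E7) :
    isotropyRep p ℓ h x = ℓ.symm (isotropyDeriv p h (ℓ x)) := rfl

end Action

end ToricG2

/-! ### The stabilizer as a group of cross product automorphisms -/

namespace ToricG2

section Action

variable {M : Type*} [TopologicalSpace M] [T2Space M] [ConnectedSpace M]
  [ChartedSpace (EuclideanSpace ℝ (Fin 7)) M] [IsManifold (𝓡 7) ∞ M]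
  [MulAction T3 M] [FaithfulSMul T3 M] [ContMDiffSMul modelT3 (𝓡 7) ∞ T3 M]

/-- The stabilizer of a point acts faithfully by automorphisms of the cross product, and fixes
the velocities of the one-parameter groups, on which the model form vanishes. -/
theorem exists_isotropy_representation (φ : ThreeForm M) (hφ : IsG2Structure φ)
    (hpres : Preserves φ) (hiso : IsotropicOrbits φ) (p : M) :
    ∃ (ρ : MulAction.stabilizer T3 p →* (E7 ≃ₗ[ℝ] E7)) (Ξ : (Fin 3 → ℝ) →ₗ[ℝ] E7),
      (∀ h, PreservesCross (ρ h).toLinearMap) ∧ Function.Injective ρ ∧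
      (∀ x, Continuous fun h => ρ h x) ∧ (∀ h v, ρ h (Ξ v) = Ξ v) ∧
      LinearMap.ker Ξ = lieAlgebraOf (MulAction.stabilizer T3 p) ∧
      ∀ u v w, ⟪cross (Ξ u) (Ξ v), Ξ w⟫ = 0 := by
  obtain ⟨L, hL⟩ := hφ.pointwise p
  let ℓ : E7 ≃ₗ[ℝ] E7 := (WithLp.linearEquiv 2 ℝ (Fin 7 → ℝ)).trans L
  -- The non-dependent type allows rewriting along `h • p = p`.
  let Φ : M → E7 [⋀^Fin 3]→L[ℝ] ℝ := φ
  have hℓ : ∀ u v w : E7, Φ p ![ℓ u, ℓ v, ℓ w] = ⟪cross u v, w⟫ := by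
    intro u v w
    rw [← phi0_eq_inner_cross, ← hL]
    change Φ p _ = Φ p _
    congr 1
    ext i
    fin_cases i <;> rfl
  have hΦ : ∀ (h : MulAction.stabilizer T3 p) (u v w : E7),
      Φ p ![isotropyDeriv p h u, isotropyDeriv p h v, isotropyDeriv p h w] = Φ p ![u, v, w] := by
    intro h u v w
    have h1 : (Φ ((h : T3) • p)).compContinuousLinearMap
        (mfderiv (𝓡 7) (𝓡 7) (fun x : M => (h : T3) • x) p : E7 →L[ℝ] E7) = Φ p := hpres h p
    have hh : (h : T3) • p = p := h.2
    rw [mfderiv_smul_eq hh, hh] at h1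
    refine Eq.trans ?_ (congrArg (fun f => f ![u, v, w]) h1)
    change Φ p _ = Φ p _
    congr 1
    ext i
    fin_cases i <;> rfl
  refine ⟨isotropyRep p ℓ, ℓ.symm.toLinearMap ∘ₗ (velocity p).toLinearMap, ?_, ?_, ?_, ?_, ?_, ?_⟩
  · intro h x y z
    rw [← hℓ, ← hℓ]
    simp [isotropyRep_apply, hΦ]
  · rw [injective_iff_map_eq_one]
    intro h hh
    refine Subtype.ext (eq_one_of_isotropyDeriv_eq_id h.2 ?_)
    ext1 x
    have h1 : isotropyRep p ℓ h (ℓ.symm x) = ℓ.symm x := by rw [hh]; rfl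
    rw [isotropyRep_apply, ℓ.apply_symm_apply] at h1
    exact ℓ.symm.injective h1
  · intro x
    have h1 := (continuous_isotropyHom p).clm_apply (continuous_const (y := ℓ x))
    exact ℓ.symm.toLinearMap.continuous_of_finiteDimensional.comp h1
  · intro h v
    rw [isotropyRep_apply]
    simp [isotropyDeriv_velocity h.2]
  · ext v
    rw [← velocity_eq_zero_iff]
    simp
  · intro u v w
    rw [← hℓ]
    have h1 := hiso p ![u, v, w]
    have h2 : Φ p (fun i => velocity p (![u, v, w] i)) = 0 := by
      rw [← h1]
      refine congrArg (Φ p) (funext fun i => ?_)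
      exact (fundamental_eq_velocity p _).symm
    rw [← h2]
    congr 1
    ext i
    fin_cases i <;> simp

end Action

/-! ### Structure of the stabilizer, by dimension -/

theorem exists_sq_T3 (g : T3) : ∃ k : T3, g = k ^ 2 := by
  refine ⟨expT3 ((1 / 2 : ℝ) • logT3 g), ?_⟩
  rw [sq, ← expT3_add, ← add_smul]
  norm_num [expT3_logT3]

theorem eq_top_of_lieDim_eq_three {H : Subgroup T3} (hH : lieDim H = 3) : H = ⊤ := by
  have htop : lieAlgebraOf H = ⊤ := Submodule.eq_top_of_finrank_eq (by simpa [lieDim] using hH)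
  refine eq_top_iff.mpr fun g _ => ?_
  have hmem : logT3 g ∈ lieAlgebraOf H := htop ▸ Submodule.mem_top
  have := hmem 1
  rwa [one_smul, expT3_logT3] at this

theorem isConnected_of_continuousMulEquiv {ι : Type*} {H : Subgroup T3}
    (e : H ≃ₜ* (ι → Circle)) : IsConnected (H : Set T3) := by
  have : ConnectedSpace Circle := Circle.exp_surjective.connectedSpace Circle.exp.continuous
  have : ConnectedSpace H := e.symm.surjective.connectedSpace e.symm.continuous
  exact isConnected_iff_connectedSpace.mpr this

/-- A closed subgroup of the torus with a representation as in
`exists_isotropy_representation` is a torus of dimension at most two. -/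
theorem structure_of_representation {H : Subgroup T3} (hH : IsClosed (H : Set T3))
    (ρ : H →* (E7 ≃ₗ[ℝ] E7)) (Ξ : (Fin 3 → ℝ) →ₗ[ℝ] E7)
    (hρ : ∀ h, PreservesCross (ρ h).toLinearMap) (hinj : Function.Injective ρ)
    (hcont : ∀ x, Continuous fun h => ρ h x) (hfix : ∀ h v, ρ h (Ξ v) = Ξ v)
    (hker : LinearMap.ker Ξ = lieAlgebraOf H)
    (hiso : ∀ u v w, ⟪cross (Ξ u) (Ξ v), Ξ w⟫ = 0) :
    lieDim H ≤ 2 ∧ Nonempty (H ≃ₜ* (Fin (lieDim H) → Circle)) := by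
  have hrank : Module.finrank ℝ (LinearMap.range Ξ) + lieDim H = 3 := by
    have := Ξ.finrank_range_add_finrank_ker
    rwa [hker, Module.finrank_fin_fun] at this
  have hSfix : ∀ x ∈ LinearMap.range Ξ, ∀ h, ρ h x = x := by
    rintro _ ⟨v, rfl⟩ h
    exact hfix h v
  have htwo : ∀ u : E7, u ≠ 0 → (∀ h, ρ h u = u) → ∃ χ : H →* (Fin 2 → Circle),
      Continuous χ ∧ Function.Injective χ := by
    intro u hu hfixu
    obtain ⟨χ₁, χ₂, hc₁, hc₂, hχ⟩ := exists_two_characters ρ hρ hcont (u := ‖u‖⁻¹ • u)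
      (by
        rw [real_inner_smul_left, real_inner_smul_right, real_inner_self_eq_norm_sq]
        have := norm_ne_zero_iff.mpr hu
        field_simp)
      (fun h => by rw [map_smul, hfixu])
    refine ⟨MonoidHom.pi ![χ₁, χ₂], ?_, ?_⟩
    · refine continuous_pi fun i => ?_
      fin_cases i
      · exact hc₁
      · exact hc₂
    · rw [injective_iff_map_eq_one]
      intro h hh
      exact (injective_iff_map_eq_one ρ).mp hinj h (hχ h (congrFun hh 0) (congrFun hh 1))
  set b := stdOrthonormalBasis ℝ (LinearMap.range Ξ) with hb
  have hb1 : ∀ i, ⟪(b i : E7), (b i : E7)⟫ = 1 := fun i => by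
    have := orthonormal_iff_ite.mp b.orthonormal i i
    simpa only [Submodule.coe_inner, if_true] using this
  have hb0 : ∀ i j, i ≠ j → ⟪(b i : E7), (b j : E7)⟫ = 0 := fun i j hij => by
    have := orthonormal_iff_ite.mp b.orthonormal i j
    simpa only [Submodule.coe_inner, if_neg hij] using this
  have hbne : ∀ i, (b i : E7) ≠ 0 := fun i h0 => by
    have := hb1 i
    rw [h0, inner_zero_left] at this
    exact zero_ne_one this
  have hle : lieDim H ≤ 3 := by omega
  interval_cases hd : lieDim H
  · refine ⟨by norm_num, ?_⟩
    let i : Fin 3 → Fin (Module.finrank ℝ (LinearMap.range Ξ)) := Fin.cast (by omega)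
    have hi : Function.Injective i := Fin.cast_injective _
    obtain ⟨u, hu⟩ := (b (i 0)).2
    obtain ⟨v, hv⟩ := (b (i 1)).2
    obtain ⟨w, hw⟩ := (b (i 2)).2
    have hcr := hiso u v w
    rw [hu, hv, hw] at hcr
    -- Isotropy of the orbit is exactly the condition that the third vector be orthogonal to the
    -- cross product of the first two.
    have htriv : ∀ h, ρ h = 1 := fun h =>
      (hρ h).eq_one_of_fixed (hSfix _ (b (i 0)).2 h) (hSfix _ (b (i 1)).2 h)
        (hSfix _ (b (i 2)).2 h) (hbne _) (hbne _) (hbne _) (hb0 _ _ (hi.ne (by decide)))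
        (hb0 _ _ (hi.ne (by decide))) (hb0 _ _ (hi.ne (by decide))) hcr
    exact nonempty_continuousMulEquiv H hH 1 continuous_const
      (fun h k _ => hinj (by rw [htriv, htriv])) (by simpa using hd)
  · refine ⟨by norm_num, ?_⟩
    let i : Fin 2 → Fin (Module.finrank ℝ (LinearMap.range Ξ)) := Fin.cast (by omega)
    have hi : Function.Injective i := Fin.cast_injective _
    have hfix1 := hSfix _ (b (i 1)).2
    obtain ⟨χ, hc, hχ⟩ := exists_second_character ρ hρ hcont (hb1 (i 0)) (hSfix _ (b (i 0)).2)
      (hb1 (i 1)) (hb0 _ _ (hi.ne (by decide))) (fun h => ⟨1, 0, by rw [hfix1]; simp⟩)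
    refine nonempty_continuousMulEquiv H hH (MonoidHom.pi fun _ => χ)
      (continuous_pi fun _ => hc) ?_ (by simpa using hd)
    rw [injective_iff_map_eq_one]
    intro h hh
    exact (injective_iff_map_eq_one ρ).mp hinj h (hχ h (hfix1 h) (congrFun hh 0))
  · refine ⟨le_rfl, ?_⟩
    obtain ⟨χ, hc, hχ⟩ := htwo _ (hbne (Fin.cast (by omega) (0 : Fin 1))) (hSfix _ (b _).2)
    exact nonempty_continuousMulEquiv H hH χ hc hχ (by simpa using hd)
  -- No velocity survives to be a fixed vector; divisibility of the full torus supplies one.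
  · have htop := eq_top_of_lieDim_eq_three hd
    obtain ⟨u, hu, hfixu⟩ := exists_fixed_of_square ρ hρ (fun h => by
      obtain ⟨k, hk⟩ := exists_sq_T3 h
      exact ⟨⟨k, htop ▸ Subgroup.mem_top k⟩, Subtype.ext hk⟩)
    obtain ⟨χ, hc, hχ⟩ := htwo u hu hfixu
    have := lieDim_le_card H χ hc hχ
    rw [hd] at this
    simp at this

/-- A power of the circle indexed by `Fin 2` is a product of two circles. -/
def finTwoCircle : (Fin 2 → Circle) ≃ₜ* Circle × Circle where
  toFun f := (f 0, f 1)
  invFun z := ![z.1, z.2]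
  left_inv f := by
    ext i
    fin_cases i <;> rfl
  right_inv _ := rfl
  map_mul' _ _ := rfl
  continuous_toFun := by fun_prop
  continuous_invFun := by fun_prop

/-- A power of the circle indexed by `Fin 1` is the circle. -/
def finOneCircle : (Fin 1 → Circle) ≃ₜ* Circle where
  toFun f := f 0
  invFun z := fun _ => z
  left_inv f := by
    ext i
    rw [Subsingleton.elim i 0]
  right_inv _ := rfl
  map_mul' _ _ := rfl
  continuous_toFun := by fun_prop
  continuous_invFun := by fun_prop

end ToricG2

theorem mainTheorem6 {M : Type*} [TopologicalSpace M] [T2Space M] [ConnectedSpace M]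
    [ChartedSpace (EuclideanSpace ℝ (Fin 7)) M] [IsManifold (𝓡 7) ∞ M]
    [MulAction ToricG2.T3 M] [FaithfulSMul ToricG2.T3 M]
    [ContMDiffSMul ToricG2.modelT3 (𝓡 7) ∞ ToricG2.T3 M]
    (φ : ToricG2.ThreeForm M) (hφ : ToricG2.IsG2Structure φ)
    (hpres : ToricG2.Preserves φ) (hiso : ToricG2.IsotropicOrbits φ) (p : M) :
    IsConnected (MulAction.stabilizer ToricG2.T3 p : Set ToricG2.T3) ∧
      ToricG2.lieDim (MulAction.stabilizer ToricG2.T3 p) ≤ 2 ∧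
      (MulAction.stabilizer ToricG2.T3 p = ⊥ ∨
        Nonempty (MulAction.stabilizer ToricG2.T3 p ≃ₜ* Circle) ∨
        Nonempty (MulAction.stabilizer ToricG2.T3 p ≃ₜ* Circle × Circle)) := by
  obtain ⟨ρ, Ξ, hρ, hinj, hcont, hfix, hker, hcross⟩ :=
    ToricG2.exists_isotropy_representation φ hφ hpres hiso p
  obtain ⟨hdim, ⟨e⟩⟩ := ToricG2.structure_of_representation
    (ToricG2.isClosed_stabilizer_T3 p) ρ Ξ hρ hinj hcont hfix hker hcross
  refine ⟨ToricG2.isConnected_of_continuousMulEquiv e, hdim, ?_⟩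
  generalize ToricG2.lieDim (MulAction.stabilizer ToricG2.T3 p) = d at e hdim
  interval_cases d
  · left
    refine (Subgroup.eq_bot_iff_forall _).mpr fun g hg => ?_
    exact congrArg Subtype.val (e.injective (Subsingleton.elim (e ⟨g, hg⟩) (e 1)))
  · exact Or.inr (Or.inl ⟨e.trans ToricG2.finOneCircle⟩)
  · exact Or.inr (Or.inr ⟨e.trans ToricG2.finTwoCircle⟩)
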